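/- A convex body in $\mathbb R^2$ is a compact convex set with non-empty interior. The support function of a convex body $D$ is $h_D(x)=\max\{\langle x,y\rangle : y\in D\}$; we say that $D$ has a $C^2$ support function if $h_D$ is of class $C^2$ on $\mathbb R^2\setminus\{0\}$ (such a $D$ is strictly convex). A line supports $D$ if it meets $D$ and $D$ lies in one of the two closed half-planes bounded by it. Two convex bodies $D_1,D_2\subset\mathbb R^2$ are called admissible if both have $C^2$ support functions, $D_1\cup D_2$ is not convex, and there are exactly two lines that support both $D_1$ and $D_2$ and do not separate $D_1$ and $D_2$ (a line separates them if they lie in different closed half-planes bounded by it). For a point $p$ in the interior of a convex body $K$ and a unit vector $u$, let $\rho_{K,p}(u)=\max\{r\ge 0 : p+ru\in K\}$ be the radial function of $K$ with respect to $p$. If $D$ is a strictly convex body in the interior of $K$, $\xi\in S^1$, and $p$ is the unique point of contact of $D$ with its supporting line with outer unit normal $\xi$, put $\rho_{K,D}(u,\xi)=\rho_{K,p}(u)$ for $u\in S^1$, $u\perp\xi$. Theorem. Let $K$ and $L$ be convex bodies in $\mathbb R^2$, and let $D_1,D_2$ be two admissible convex bodies contained in the interior of $K\cap L$. Assume that for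 some real number $i>0$ one of the following two conditions holds: (I) $\rho_{K,D_j}^i(u,\xi)+\rho_{K,D_j}^i(-u,\xi)=\rho_{L,D_j}^i(u,\xi)+\rho_{L,D_j}^i(-u,\xi)$ for $j=1,2$ and all $\xi,u\in S^1$ with $u\perp\xi$; (II) $\partial K\cap\partial L\neq\emptyset$ and $\rho_{K,D_j}^i(u,\xi)-\rho_{K,D_j}^i(-u,\xi)=\rho_{L,D_j}^i(u,\xi)-\rho_{L,D_j}^i(-u,\xi)$ for $j=1,2$ and all $\xi,u\in S^1$ with $u\perp\xi$. Then $K=L$. -/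

import Mathlib

open scoped RealInnerProductSpace

/-- The Euclidean plane. -/
abbrev Plane : Type := EuclideanSpace ℝ (Fin 2)

/-- A convex body: a compact convex set with non-empty interior. -/
structure IsConvexBody (K : Set Plane) : Prop where
  convex : Convex ℝ K
  isCompact : IsCompact K
  interior_nonempty : (interior K).Nonempty

/-- The support function `h_K(x) = max {⟨x, y⟩ : y ∈ K}`. -/
noncomputable def supportFun (K : Set Plane) (x : Plane) : ℝ :=
  sSup ((fun y => ⟪x, y⟫) '' K)

/-- `K` has a `C²` support function: `h_K` is of class `C²` on the plane without the origin. -/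
def HasC2SupportFun (K : Set Plane) : Prop :=
  ContDiffOn ℝ 2 (supportFun K) {0}ᶜ

/-- The line `{x : ⟨ξ, x⟩ = c}` (used with unit vectors `ξ`). -/
def normalLine (ξ : Plane) (c : ℝ) : Set Plane := {x | ⟪ξ, x⟫ = c}

/-- `H` is a supporting line of `D`: a line that meets `D` and has `D` in one of the two closed
half-planes that it bounds. (Replacing `(ξ, c)` by `(-ξ, -c)` exchanges the two half-planes.) -/
def IsSupportingLine (H D : Set Plane) : Prop :=
  ∃ (ξ : Plane) (c : ℝ), ‖ξ‖ = 1 ∧ H = normalLine ξ c ∧ (D ∩ H).Nonempty ∧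
    ∀ x ∈ D, ⟪ξ, x⟫ ≤ c

/-- The line `H` separates `D₁` and `D₂`: they lie in different closed half-planes
bounded by `H`. -/
def LineSeparates (H D₁ D₂ : Set Plane) : Prop :=
  ∃ (ξ : Plane) (c : ℝ), ‖ξ‖ = 1 ∧ H = normalLine ξ c ∧
    (∀ x ∈ D₁, ⟪ξ, x⟫ ≤ c) ∧ (∀ x ∈ D₂, c ≤ ⟪ξ, x⟫)

/-- Admissible pairs of convex bodies in the plane. -/
structure Admissible (D₁ D₂ : Set Plane) : Prop where
  isConvexBody_left : IsConvexBody D₁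
  isConvexBody_right : IsConvexBody D₂
  c2_left : HasC2SupportFun D₁
  c2_right : HasC2SupportFun D₂
  union_not_convex : ¬ Convex ℝ (D₁ ∪ D₂)
  two_lines : {H : Set Plane | IsSupportingLine H D₁ ∧ IsSupportingLine H D₂ ∧
    ¬ LineSeparates H D₁ D₂}.encard = 2

/-- The radial function `ρ_{K,p}(u) = ‖u‖_{K-p}⁻¹` of `K` with respect to `p`, where `‖·‖_{K-p}`
is the Minkowski functional of `K - p`. -/
noncomputable def radialAt (K : Set Plane) (p u : Plane) : ℝ :=
  (gauge ((fun x => x - p) '' K) u)⁻¹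

/-- The point of contact of `D` and its supporting line with outer normal `ξ`. For a strictly
convex body (in particular, for one with a `C²` support function) there is exactly one such
point when `ξ ≠ 0`. -/
noncomputable def contactPoint (D : Set Plane) (ξ : Plane) : Plane :=
  Classical.epsilon fun p => p ∈ D ∩ normalLine ξ (supportFun D ξ)

/-- The contact point of a convex body is a point of contact. -/
theorem contactPoint_mem {D : Set Plane} (hD : IsConvexBody D) (ξ : Plane) :
    contactPoint D ξ ∈ D ∩ normalLine ξ (supportFun D ξ) := by
  refine Classical.epsilon_spec (p := fun p => p ∈ D ∩ normalLine ξ (supportFun D ξ)) ?_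
  have hne : D.Nonempty := hD.interior_nonempty.mono interior_subset
  have hc : ContinuousOn (fun y : Plane => ⟪ξ, y⟫) D := by fun_prop
  obtain ⟨p, hp, h⟩ := hD.isCompact.exists_sSup_image_eq hne hc
  exact ⟨p, hp, h.symm⟩

/-- `ρ_{K,D}(u, ξ) = ρ_{K,p}(u)`, where `p` is the point of contact of `D` and its supporting line
with outer unit normal `ξ`, and `u` is a unit vector orthogonal to `ξ`. -/
noncomputable def chordRadial (K D : Set Plane) (u ξ : Plane) : ℝ :=
  radialAt K (contactPoint D ξ) u

open Filter Topology Set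

/-! ### Support functions and contact points -/

/-! Both conditions say that on each tangent of `D₁` or `D₂` the gaps between `∂K` and `∂L` at the
two ends, measured through `i`-th powers, have the same absolute value (`IsChordEquivalent`). So if
`K` and `L` share one end of a tangent chord they share the other, and coincidence of boundary
points propagates along chains of tangent chords.

Admissibility gives exactly two unit normals at which the support functions agree, and at one of
them, `e`, the contact points differ; otherwise the union would be convex
(`Admissible.exists_normals`). On one side of `e` the body `D₁` reaches further out, on the other
`D₂` does. Following chords of `L` tangent to `D₁` and `D₂` alternately, each step starting at the
end of the previous chord, turns the tangent monotonically towards the common one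
(`exists_alternating_chords`).

If some chord of the chain is common to `K` and `L`, so are all, and in the limit so is the chord on
the common tangent. For the converse (`not_alternating_of_gap`), suppose that the limit chord is
common but those of the chain are not. Let `aⱼ`, `bⱼ` be the forward and backward radii from `Dⱼ` on
the common tangent. Crossing a chord of `D₁` from front to back multiplies the gap by about
`(a₁/b₁)^(i-1)`, crossing one of `D₂` from back to front by about `(b₂/a₂)^(i-1)`, and changing
chords at a shared end by about `1`. A double step changes the sine of the angle by the factor `(b₁
a₂)/(b₂ a₁)`. Hence gap divided by sine grows by a factor tending to `((a₁ b₂)/(b₁ a₂))^i > 1`,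
while the Lipschitz property of the boundaries keeps it bounded (`exists_gap_le`), a contradiction.

Thus all tangent chords of `D₁`, except possibly the one at the second common normal, are common
exactly when the chord at `e` is (`hasCommonChord_iff_of_normals`). Every point of `∂L` is an end of
a chord of this kind, so `∂L` lies in `∂K` or misses it (`mem_frontier_iff_hasCommonChord`). The
boundaries meet, by hypothesis in the difference case and by an intermediate value argument in the
sum case (`frontier_inter_nonempty_of_add_eq`). -/

theorem IsConvexBody.inner_le_supportFun {D : Set Plane} (hD : IsConvexBody D) (x : Plane)
    {y : Plane} (hy : y ∈ D) : ⟪x, y⟫ ≤ supportFun D x := by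
  have hc : ContinuousOn (fun y : Plane => ⟪x, y⟫) D := by fun_prop
  exact le_csSup (hD.isCompact.bddAbove_image hc) (mem_image_of_mem _ hy)

theorem IsConvexBody.contactPoint_mem_self {D : Set Plane} (hD : IsConvexBody D) (x : Plane) :
    contactPoint D x ∈ D := (contactPoint_mem hD x).1

theorem IsConvexBody.inner_contactPoint {D : Set Plane} (hD : IsConvexBody D) (x : Plane) :
    ⟪x, contactPoint D x⟫ = supportFun D x := (contactPoint_mem hD x).2

theorem IsConvexBody.supportFun_smul {D : Set Plane} (hD : IsConvexBody D) {a : ℝ} (ha : 0 ≤ a)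
    (x : Plane) : supportFun D (a • x) = a * supportFun D x := by
  apply le_antisymm
  · rw [← hD.inner_contactPoint (a • x), real_inner_smul_left]
    exact mul_le_mul_of_nonneg_left (hD.inner_le_supportFun x (hD.contactPoint_mem_self _)) ha
  · rw [← hD.inner_contactPoint x, ← real_inner_smul_left]
    exact hD.inner_le_supportFun _ (hD.contactPoint_mem_self _)

theorem IsConvexBody.inner_lt_supportFun {D : Set Plane} (hD : IsConvexBody D) {x : Plane}
    (hx : x ≠ 0) {p : Plane} (hp : p ∈ interior D) : ⟪x, p⟫ < supportFun D x := by
  have hcont : Tendsto (fun t : ℝ => p + t • x) (𝓝[>] 0) (𝓝 p) := by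
    have : Continuous (fun t : ℝ => p + t • x) := by fun_prop
    simpa using (this.tendsto 0).mono_left nhdsWithin_le_nhds
  obtain ⟨t, ht, ht0⟩ := ((hcont.eventually (isOpen_interior.mem_nhds hp)).and
    self_mem_nhdsWithin).exists
  have h1 := hD.inner_le_supportFun x (interior_subset ht)
  rw [inner_add_right, real_inner_smul_right] at h1
  have h2 : 0 < ⟪x, x⟫ := real_inner_self_pos.2 hx
  have := mul_pos (show (0 : ℝ) < t from ht0) h2
  linarith

theorem IsConvexBody.width_pos {D : Set Plane} (hD : IsConvexBody D) {x : Plane}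
    (hx : x ≠ 0) : 0 < supportFun D x + supportFun D (-x) := by
  obtain ⟨p, hp⟩ := hD.interior_nonempty
  have h1 := hD.inner_lt_supportFun hx hp
  have h2 := hD.inner_le_supportFun (-x) (interior_subset hp)
  rw [inner_neg_left] at h2
  linarith

theorem HasC2SupportFun.differentiableAt {D : Set Plane} (hc : HasC2SupportFun D) {x : Plane}
    (hx : x ≠ 0) : DifferentiableAt ℝ (supportFun D) x :=
  (hc.differentiableOn (by norm_num)).differentiableAt (isOpen_compl_singleton.mem_nhds hx)

/-- The function `h_D(y) - ⟪y, q⟫` is nonnegative and vanishes at `x`, so its derivative vanishes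
there. The contact point is therefore the gradient of the support function, which makes it
continuous in the normal. -/
theorem IsConvexBody.fderiv_supportFun {D : Set Plane} (hD : IsConvexBody D)
    (hc : HasC2SupportFun D) {x : Plane} (hx : x ≠ 0) {q : Plane} (hq : q ∈ D)
    (hxq : ⟪x, q⟫ = supportFun D x) :
    fderiv ℝ (supportFun D) x = InnerProductSpace.toDual ℝ Plane q := by
  set ℓ : StrongDual ℝ Plane := InnerProductSpace.toDual ℝ Plane q with hℓ
  have hmin : IsLocalMin (fun y => supportFun D y - ℓ y) x := by
    refine Eventually.of_forall fun y => ?_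
    simp only [hℓ, InnerProductSpace.toDual_apply_apply]
    rw [real_inner_comm x q, hxq, real_inner_comm y q]
    linarith [hD.inner_le_supportFun y hq]
  have h0 := hmin.fderiv_eq_zero
  rw [fderiv_fun_sub (hc.differentiableAt hx) ℓ.differentiableAt, ℓ.fderiv, sub_eq_zero] at h0
  exact h0

theorem IsConvexBody.continuousOn_contactPoint {D : Set Plane} (hD : IsConvexBody D)
    (hc : HasC2SupportFun D) : ContinuousOn (contactPoint D) {0}ᶜ := by
  have h1 : ContinuousOn (fun x => (InnerProductSpace.toDual ℝ Plane).symm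
      (fderiv ℝ (supportFun D) x)) {0}ᶜ :=
    (InnerProductSpace.toDual ℝ Plane).symm.continuous.comp_continuousOn
      (hc.continuousOn_fderiv_of_isOpen isOpen_compl_singleton (by norm_num))
  refine h1.congr fun x hx => ?_
  beta_reduce
  rw [hD.fderiv_supportFun hc hx (hD.contactPoint_mem_self x) (hD.inner_contactPoint x),
    LinearIsometryEquiv.symm_apply_apply]

/-- A convex body has a supporting line, with unit normal, at each of its boundary points. -/
theorem IsConvexBody.exists_normal {L : Set Plane} (hL : IsConvexBody L) {z : Plane}
    (hz : z ∈ frontier L) : ∃ v : Plane, ‖v‖ = 1 ∧ ∀ x ∈ interior L, ⟪v, x⟫ < ⟪v, z⟫ := by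
  obtain ⟨g, hg⟩ := geometric_hahn_banach_open_point hL.convex.interior isOpen_interior hz.2
  obtain ⟨w, rfl⟩ := (InnerProductSpace.toDual ℝ Plane).surjective g
  simp only [InnerProductSpace.toDual_apply_apply] at hg
  have hw : w ≠ 0 := by
    rintro rfl
    obtain ⟨p, hp⟩ := hL.interior_nonempty
    simpa using hg p hp
  have hn : 0 < ‖w‖⁻¹ := inv_pos.2 (norm_pos_iff.2 hw)
  refine ⟨‖w‖⁻¹ • w, norm_smul_inv_norm hw, fun x hx => ?_⟩
  rw [real_inner_smul_left, real_inner_smul_left]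
  exact mul_lt_mul_of_pos_left (hg x hx) hn

/-! ### Radial functions -/

theorem image_sub_mem_nhds {K : Set Plane} {p : Plane} (hp : p ∈ interior K) :
    (fun x => x - p) '' K ∈ 𝓝 (0 : Plane) := by
  have h := (Homeomorph.subRight p).isOpenMap.image_mem_nhds (mem_interior_iff_mem_nhds.1 hp)
  simpa using h

theorem IsConvexBody.convex_image_sub {K : Set Plane} (hK : IsConvexBody K) (p : Plane) :
    Convex ℝ ((fun x => x - p) '' K) := by
  simpa [sub_eq_add_neg, add_comm] using hK.convex.translate (-p)

theorem mem_frontier_image_sub {K : Set Plane} {p x : Plane} :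
    x ∈ frontier ((fun x => x - p) '' K) ↔ p + x ∈ frontier K := by
  have h := (Homeomorph.subRight p).image_frontier K
  simp only [Homeomorph.coe_subRight] at h
  rw [← h]
  constructor
  · rintro ⟨y, hy, rfl⟩
    simpa using hy
  · intro hy
    exact ⟨p + x, hy, by simp⟩

theorem IsConvexBody.gauge_image_sub_pos {K : Set Plane} (hK : IsConvexBody K) {p u : Plane}
    (hp : p ∈ interior K) (hu : u ≠ 0) : 0 < gauge ((fun x => x - p) '' K) u := by
  have hb : Bornology.IsBounded ((fun x => x - p) '' K) :=
    (hK.isCompact.image (by fun_prop)).isBounded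
  exact (gauge_pos (absorbent_nhds_zero (image_sub_mem_nhds hp))
    ((NormedSpace.isVonNBounded_iff ℝ).2 hb)).2 hu

/-- The boundary is where the gauge equals `1`, and the gauge is positive and homogeneous along the
ray. The uniqueness half is what later identifies a boundary point on a tangent as a chord end. -/
theorem IsConvexBody.add_smul_mem_frontier_iff {K : Set Plane} (hK : IsConvexBody K)
    {p u : Plane} (hp : p ∈ interior K) (hu : u ≠ 0) {t : ℝ} (ht : 0 < t) :
    p + t • u ∈ frontier K ↔ t = radialAt K p u := by
  rw [← mem_frontier_image_sub, ← gauge_eq_one_iff_mem_frontier (hK.convex_image_sub p)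
    (image_sub_mem_nhds hp), gauge_smul_of_nonneg ht.le, smul_eq_mul, radialAt]
  have h := hK.gauge_image_sub_pos hp hu
  rw [← one_div, eq_div_iff h.ne']

theorem IsConvexBody.radialAt_pos {K : Set Plane} (hK : IsConvexBody K)
    {p u : Plane} (hp : p ∈ interior K) (hu : u ≠ 0) : 0 < radialAt K p u :=
  inv_pos.2 (hK.gauge_image_sub_pos hp hu)

theorem IsConvexBody.add_radialAt_smul_mem {K : Set Plane} (hK : IsConvexBody K)
    {p u : Plane} (hp : p ∈ interior K) (hu : u ≠ 0) :
    p + radialAt K p u • u ∈ frontier K :=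
  (hK.add_smul_mem_frontier_iff hp hu (hK.radialAt_pos hp hu)).2 rfl

/-- A compactness argument: the radii stay in a compact interval, and since `frontier K` is closed
every cluster value is again a boundary parameter on the limit ray, hence the radius there. -/
theorem IsConvexBody.tendsto_radialAt {K : Set Plane} (hK : IsConvexBody K) {ι : Type*}
    {l : Filter ι} {p u : ι → Plane} {p₀ u₀ : Plane} (hp₀ : p₀ ∈ interior K) (hu₀ : u₀ ≠ 0)
    (hp : Tendsto p l (𝓝 p₀)) (hu : Tendsto u l (𝓝 u₀)) :
    Tendsto (fun n => radialAt K (p n) (u n)) l (𝓝 (radialAt K p₀ u₀)) := by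
  obtain ⟨R, hR⟩ := hK.isCompact.isBounded.exists_norm_le
  have hpe : ∀ᶠ n in l, p n ∈ interior K := hp.eventually (isOpen_interior.mem_nhds hp₀)
  have hue : ∀ᶠ n in l, ‖u₀‖ / 2 < ‖u n‖ :=
    hu.norm.eventually_const_lt (half_lt_self (norm_pos_iff.2 hu₀))
  have hn : 0 < ‖u₀‖ := norm_pos_iff.2 hu₀
  -- The chord piece has length at most `2 * R`, and its direction has norm greater than `‖u₀‖ / 2`.
  have hbd : ∀ᶠ n in l, radialAt K (p n) (u n) ∈ Icc 0 (4 * R / ‖u₀‖) := by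
    filter_upwards [hpe, hue] with n h1 h2
    have hun : u n ≠ 0 := by
      intro h
      rw [h, norm_zero] at h2
      linarith
    have h3 := hK.radialAt_pos h1 hun
    have h4 := hK.isCompact.isClosed.frontier_subset (hK.add_radialAt_smul_mem h1 hun)
    refine ⟨h3.le, ?_⟩
    have h5 : ‖radialAt K (p n) (u n) • u n‖ ≤ R + R := by
      calc _ = ‖(p n + radialAt K (p n) (u n) • u n) - p n‖ := by rw [add_sub_cancel_left]
        _ ≤ _ := (norm_sub_le _ _).trans (add_le_add (hR _ h4) (hR _ (interior_subset h1)))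
    rw [norm_smul, Real.norm_of_nonneg h3.le] at h5
    rw [le_div_iff₀ hn]
    nlinarith
  refine isCompact_Icc.tendsto_nhds_of_unique_mapClusterPt hbd fun t ht hcl => ?_
  obtain ⟨U, hUl, hU⟩ := mapClusterPt_iff_ultrafilter.1 hcl
  have hlim : Tendsto (fun n => p n + radialAt K (p n) (u n) • u n) U (𝓝 (p₀ + t • u₀)) :=
    (hp.mono_left hUl).add (hU.smul (hu.mono_left hUl))
  have hfr : p₀ + t • u₀ ∈ frontier K := by
    refine isClosed_frontier.mem_of_tendsto hlim ?_
    filter_upwards [hUl hpe, hUl hue] with n h1 h2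
    refine hK.add_radialAt_smul_mem h1 ?_
    intro h
    rw [h, norm_zero] at h2
    linarith
  have ht0 : 0 < t := by
    rcases ht.1.lt_or_eq with h | h
    · exact h
    · rw [← h, zero_smul, add_zero] at hfr
      exact absurd hp₀ hfr.2
  exact (hK.add_smul_mem_frontier_iff hp₀ hu₀ ht0).1 hfr

/-! ### Orthonormal frames of the plane -/

/-- `(e, f)` is an orthonormal frame of the plane. -/
structure IsFrame (e f : Plane) : Prop where
  norm_left : ‖e‖ = 1
  norm_right : ‖f‖ = 1
  inner_eq_zero : ⟪e, f⟫ = 0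

/-- The unit vector at angle `θ` in the frame `(e, f)`. -/
noncomputable def frameNormal (e f : Plane) (θ : ℝ) : Plane := Real.cos θ • e + Real.sin θ • f

/-- The derivative of `frameNormal`. -/
noncomputable def frameTangent (e f : Plane) (θ : ℝ) : Plane := -Real.sin θ • e + Real.cos θ • f

theorem exists_isFrame {e : Plane} (he : ‖e‖ = 1) : ∃ f, IsFrame e f := by
  have h1 := he
  rw [EuclideanSpace.norm_eq, Real.sqrt_eq_one] at h1
  simp only [Real.norm_eq_abs, sq_abs, Fin.sum_univ_two] at h1
  refine ⟨!₂[-e 1, e 0], he, ?_, ?_⟩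
  · rw [EuclideanSpace.norm_eq, Real.sqrt_eq_one]
    simp [Fin.sum_univ_two]
    linarith
  · simp [PiLp.inner_apply, Fin.sum_univ_two]
    ring

namespace IsFrame

variable {e f : Plane}

theorem neg_right (hF : IsFrame e f) : IsFrame e (-f) :=
  ⟨hF.norm_left, by rw [norm_neg, hF.norm_right], by rw [inner_neg_right, hF.inner_eq_zero, neg_zero]⟩

theorem inner_self_left (hF : IsFrame e f) : ⟪e, e⟫ = 1 := by
  rw [real_inner_self_eq_norm_sq, hF.norm_left, one_pow]

theorem inner_self_right (hF : IsFrame e f) : ⟪f, f⟫ = 1 := by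
  rw [real_inner_self_eq_norm_sq, hF.norm_right, one_pow]

theorem inner_eq_zero' (hF : IsFrame e f) : ⟪f, e⟫ = 0 := by
  rw [real_inner_comm, hF.inner_eq_zero]

theorem eq_add (hF : IsFrame e f) (x : Plane) : x = ⟪e, x⟫ • e + ⟪f, x⟫ • f := by
  have ho : Orthonormal ℝ ![e, f] := by
    constructor
    · intro i
      fin_cases i
      · exact hF.norm_left
      · exact hF.norm_right
    · intro i j hij
      fin_cases i <;> fin_cases j
      · exact absurd rfl hij
      · exact hF.inner_eq_zero
      · exact hF.inner_eq_zero'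
      · exact absurd rfl hij
  have hcard : Fintype.card (Fin 2) = Module.finrank ℝ Plane := by simp
  let b := (basisOfOrthonormalOfCardEqFinrank ho hcard).toOrthonormalBasis (by simpa using ho)
  have h := b.sum_repr' x
  simpa [b, Fin.sum_univ_two] using h.symm

theorem inner_eq (hF : IsFrame e f) (x y : Plane) :
    ⟪x, y⟫ = ⟪e, x⟫ * ⟪e, y⟫ + ⟪f, x⟫ * ⟪f, y⟫ := by
  conv_lhs => rw [hF.eq_add x]
  rw [inner_add_left, real_inner_smul_left, real_inner_smul_left]

theorem inner_normal_tangent (hF : IsFrame e f) (θ φ : ℝ) :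
    ⟪frameNormal e f φ, frameTangent e f θ⟫ = Real.sin (φ - θ) := by
  simp only [frameNormal, frameTangent, inner_add_left, inner_add_right, real_inner_smul_left,
    real_inner_smul_right, hF.inner_self_left, hF.inner_self_right, hF.inner_eq_zero,
    hF.inner_eq_zero', Real.sin_sub]
  ring

theorem isFrame_rotate (hF : IsFrame e f) (θ : ℝ) :
    IsFrame (frameNormal e f θ) (frameTangent e f θ) := by
  have h := Real.sin_sq_add_cos_sq θ
  refine ⟨?_, ?_, by rw [hF.inner_normal_tangent, sub_self, Real.sin_zero]⟩
  · rw [← sq_eq_sq₀ (norm_nonneg _) zero_le_one, ← real_inner_self_eq_norm_sq]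
    simp only [frameNormal, inner_add_left, inner_add_right, real_inner_smul_left,
      real_inner_smul_right, hF.inner_self_left, hF.inner_self_right, hF.inner_eq_zero,
      hF.inner_eq_zero']
    linarith
  · rw [← sq_eq_sq₀ (norm_nonneg _) zero_le_one, ← real_inner_self_eq_norm_sq]
    simp only [frameTangent, inner_add_left, inner_add_right, real_inner_smul_left,
      real_inner_smul_right, hF.inner_self_left, hF.inner_self_right, hF.inner_eq_zero,
      hF.inner_eq_zero']
    linarith

theorem norm_normal (hF : IsFrame e f) (θ : ℝ) : ‖frameNormal e f θ‖ = 1 :=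
  (hF.isFrame_rotate θ).norm_left

theorem norm_tangent (hF : IsFrame e f) (θ : ℝ) : ‖frameTangent e f θ‖ = 1 :=
  (hF.isFrame_rotate θ).norm_right

theorem normal_ne_zero (hF : IsFrame e f) (θ : ℝ) : frameNormal e f θ ≠ 0 := by
  intro h
  simpa [h] using hF.norm_normal θ

theorem tangent_ne_zero (hF : IsFrame e f) (θ : ℝ) : frameTangent e f θ ≠ 0 := by
  intro h
  simpa [h] using hF.norm_tangent θ

theorem inner_left_tangent (hF : IsFrame e f) (θ : ℝ) :
    ⟪e, frameTangent e f θ⟫ = -Real.sin θ := by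
  simp [frameTangent, inner_add_right, real_inner_smul_right, hF.norm_left,
    hF.inner_eq_zero]

theorem inner_right_tangent (hF : IsFrame e f) (θ : ℝ) :
    ⟪f, frameTangent e f θ⟫ = Real.cos θ := by
  simp [frameTangent, inner_add_right, real_inner_smul_right, hF.norm_right,
    hF.inner_eq_zero']

/-- A unit vector with positive component along the tangent at `φ` has its angle in
`(φ, φ + π)`. -/
theorem exists_angle (hF : IsFrame e f) (φ : ℝ) {v : Plane} (hv : ‖v‖ = 1)
    (hpos : 0 < ⟪v, frameTangent e f φ⟫) :
    ∃ ψ, φ < ψ ∧ ψ < φ + Real.pi ∧ v = frameNormal e f ψ := by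
  have hG := hF.isFrame_rotate φ
  set a := ⟪frameNormal e f φ, v⟫ with ha
  set b := ⟪frameTangent e f φ, v⟫ with hb
  have hb0 : 0 < b := by rw [hb, real_inner_comm]; exact hpos
  have hab : a * a + b * b = 1 := by
    rw [← hG.inner_eq v v, real_inner_self_eq_norm_sq, hv, one_pow]
  have ha1 : -1 < a := by nlinarith
  have ha2 : a < 1 := by nlinarith
  refine ⟨φ + Real.arccos a, by linarith [Real.arccos_pos.2 ha2], ?_, ?_⟩
  · have : Real.arccos a ≠ Real.pi := by
      rw [Ne, Real.arccos_eq_pi]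
      linarith
    have := lt_of_le_of_ne (Real.arccos_le_pi a) this
    linarith
  · have hs : Real.sin (Real.arccos a) = b := by
      rw [Real.sin_arccos, show 1 - a ^ 2 = b ^ 2 by linarith, Real.sqrt_sq hb0.le]
    have hc : Real.cos (Real.arccos a) = a := Real.cos_arccos ha1.le ha2.le
    rw [hG.eq_add v, ← ha, ← hb, frameNormal, frameNormal, frameTangent, Real.cos_add,
      Real.sin_add, hs, hc]
    module

theorem exists_angle_mem_Ico (hF : IsFrame e f) (c : ℝ) {v : Plane} (hv : ‖v‖ = 1) :
    ∃ ψ ∈ Ico c (c + 2 * Real.pi), v = frameNormal e f ψ := by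
  have hper : Function.Periodic (frameNormal e f) (2 * Real.pi) := fun x => by
    simp [frameNormal]
  have hex : ∃ ψ, v = frameNormal e f ψ := by
    have hab : ⟪e, v⟫ * ⟪e, v⟫ + ⟪f, v⟫ * ⟪f, v⟫ = 1 := by
      rw [← hF.inner_eq v v, real_inner_self_eq_norm_sq, hv, one_pow]
    rcases lt_trichotomy ⟪f, v⟫ 0 with h | h | h
    · obtain ⟨ψ, -, -, h3⟩ := hF.exists_angle Real.pi hv
        (by simpa [frameTangent, real_inner_comm f v] using h)
      exact ⟨ψ, h3⟩
    · rw [h] at hab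
      have : ⟪e, v⟫ = 1 ∨ ⟪e, v⟫ = -1 := by
        rw [mul_zero, add_zero] at hab
        exact mul_self_eq_one_iff.1 hab
      rcases this with h1 | h1
      · refine ⟨0, ?_⟩
        conv_lhs => rw [hF.eq_add v]
        simp [frameNormal, h1, h]
      · refine ⟨Real.pi, ?_⟩
        conv_lhs => rw [hF.eq_add v]
        simp [frameNormal, h1, h]
    · obtain ⟨ψ, -, -, h3⟩ := hF.exists_angle 0 hv
        (by simpa [frameTangent, real_inner_comm f v] using h)
      exact ⟨ψ, h3⟩
  obtain ⟨ψ, rfl⟩ := hex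
  obtain ⟨y, hy, h⟩ := hper.exists_mem_Ico Real.two_pi_pos ψ c
  exact ⟨y, hy, h⟩

end IsFrame

theorem continuous_frameNormal (e f : Plane) : Continuous (frameNormal e f) := by
  unfold frameNormal
  fun_prop

theorem continuous_frameTangent (e f : Plane) : Continuous (frameTangent e f) := by
  unfold frameTangent
  fun_prop

theorem frameNormal_zero (e f : Plane) : frameNormal e f 0 = e := by simp [frameNormal]

theorem frameTangent_zero (e f : Plane) : frameTangent e f 0 = f := by simp [frameTangent]

theorem frameNormal_neg (e f : Plane) (θ : ℝ) : frameNormal e (-f) θ = frameNormal e f (-θ) := by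
  simp [frameNormal]

theorem frameNormal_add_pi (e f : Plane) (θ : ℝ) :
    frameNormal e f (θ + Real.pi) = -frameNormal e f θ := by
  simp [frameNormal]
  module

/-! ### Tangent chords of two bodies -/

section Tangents

variable {e f : Plane} {D D₁ D₂ L : Set Plane}

theorem IsFrame.eq_contactPoint_add (hF : IsFrame e f) (hD : IsConvexBody D) {θ : ℝ} {z : Plane}
    (hz : ⟪frameNormal e f θ, z⟫ = supportFun D (frameNormal e f θ)) :
    ∃ t : ℝ, z = contactPoint D (frameNormal e f θ) + t • frameTangent e f θ := by
  have hG := hF.isFrame_rotate θ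
  refine ⟨⟪frameTangent e f θ, z - contactPoint D (frameNormal e f θ)⟫, ?_⟩
  have h := hG.eq_add (z - contactPoint D (frameNormal e f θ))
  rw [inner_sub_right (frameNormal e f θ), hz, hD.inner_contactPoint, sub_self, zero_smul,
    zero_add] at h
  rw [← h, add_sub_cancel]

theorem IsFrame.inner_normal_contactPoint_add (hF : IsFrame e f) (θ φ t : ℝ) :
    ⟪frameNormal e f φ, contactPoint D (frameNormal e f θ) + t • frameTangent e f θ⟫ =
      ⟪frameNormal e f φ, contactPoint D (frameNormal e f θ)⟫ + t * Real.sin (φ - θ) := by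
  rw [inner_add_right, real_inner_smul_right, hF.inner_normal_tangent]

theorem IsFrame.inner_contactPoint_add (hF : IsFrame e f) (hD : IsConvexBody D) (θ t : ℝ) :
    ⟪frameNormal e f θ, contactPoint D (frameNormal e f θ) + t • frameTangent e f θ⟫ =
      supportFun D (frameNormal e f θ) := by
  rw [hF.inner_normal_contactPoint_add, sub_self, Real.sin_zero, mul_zero, add_zero,
    hD.inner_contactPoint]

theorem IsFrame.continuous_supportFun (hF : IsFrame e f) (hc : HasC2SupportFun D) :
    Continuous fun θ => supportFun D (frameNormal e f θ) :=
  hc.continuousOn.comp_continuous (continuous_frameNormal e f) fun θ => hF.normal_ne_zero θ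

theorem IsFrame.continuous_contactPoint (hF : IsFrame e f) (hD : IsConvexBody D)
    (hc : HasC2SupportFun D) : Continuous fun θ => contactPoint D (frameNormal e f θ) :=
  (hD.continuousOn_contactPoint hc).comp_continuous (continuous_frameNormal e f)
    fun θ => hF.normal_ne_zero θ

theorem IsFrame.exists_zero (hF : IsFrame e f) (hc : HasC2SupportFun D) (z : Plane) {a b : ℝ}
    (hab : a ≤ b)
    (h : (⟪frameNormal e f a, z⟫ - supportFun D (frameNormal e f a)) *
      (⟪frameNormal e f b, z⟫ - supportFun D (frameNormal e f b)) < 0) :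
    ∃ θ, a < θ ∧ θ < b ∧ ⟪frameNormal e f θ, z⟫ = supportFun D (frameNormal e f θ) := by
  set G : ℝ → ℝ := fun θ => ⟪frameNormal e f θ, z⟫ - supportFun D (frameNormal e f θ) with hG
  have hcont : Continuous G := by
    have h1 := hF.continuous_supportFun hc
    have h2 := continuous_frameNormal e f
    exact (h2.inner continuous_const).sub h1
  have h' : G a * G b < 0 := h
  have h0 : (0 : ℝ) ∈ G '' Icc a b := by
    rcases mul_neg_iff.1 h' with h1 | h1
    · exact intermediate_value_Icc' hab hcont.continuousOn ⟨h1.2.le, h1.1.le⟩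
    · exact intermediate_value_Icc hab hcont.continuousOn ⟨h1.1.le, h1.2.le⟩
  obtain ⟨θ, hθ, hz⟩ := h0
  have hne : G a ≠ 0 ∧ G b ≠ 0 := mul_ne_zero_iff.1 h'.ne
  refine ⟨θ, lt_of_le_of_ne hθ.1 ?_, lt_of_le_of_ne hθ.2 ?_, sub_eq_zero.1 hz⟩
  · rintro rfl
    exact hne.1 hz
  · rintro rfl
    exact hne.2 hz

/-- A point behind `D₁` on a tangent of `D₁` is behind `D₂` on a tangent of `D₂` turned to a larger
angle, as long as `D₁` reaches further out than `D₂`. -/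
theorem IsFrame.exists_backward_tangent (hF : IsFrame e f) (hD₁ : IsConvexBody D₁)
    (hD₂ : IsConvexBody D₂) (hc₂ : HasC2SupportFun D₂)
    (h0 : supportFun D₁ e = supportFun D₂ e) {θ t : ℝ} (hθ : θ < 0)
    (hlt : supportFun D₂ (frameNormal e f θ) < supportFun D₁ (frameNormal e f θ)) (ht : t < 0) :
    ∃ φ s : ℝ, θ < φ ∧ φ < 0 ∧ s < 0 ∧
      contactPoint D₁ (frameNormal e f θ) + t • frameTangent e f θ =
        contactPoint D₂ (frameNormal e f φ) + s • frameTangent e f φ := by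
  set z := contactPoint D₁ (frameNormal e f θ) + t • frameTangent e f θ with hz
  have hzθ : ⟪frameNormal e f θ, z⟫ = supportFun D₁ (frameNormal e f θ) :=
    hF.inner_contactPoint_add hD₁ θ t
  have key : ∃ φ, θ < φ ∧ φ < 0 ∧ φ < θ + Real.pi ∧
      ⟪frameNormal e f φ, z⟫ = supportFun D₂ (frameNormal e f φ) := by
    have hpos : 0 < ⟪frameNormal e f θ, z⟫ - supportFun D₂ (frameNormal e f θ) := by
      rw [hzθ]; linarith
    -- If the common tangent is less than a half-turn away, the sign change occurs before it;
    -- otherwise it occurs before the opposite normal `θ + π`, because the width of `D₂` is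
    -- positive. In both cases `φ - θ < π`, which determines the sign of `s`.
    by_cases hπ : -θ < Real.pi
    · obtain ⟨φ, h1, h2, h3⟩ := hF.exists_zero hc₂ z hθ.le (by
        refine mul_neg_of_pos_of_neg hpos ?_
        rw [hz, hF.inner_normal_contactPoint_add, frameNormal_zero, ← h0]
        have h4 := hD₁.inner_le_supportFun e (hD₁.contactPoint_mem_self (frameNormal e f θ))
        have h5 : 0 < Real.sin (0 - θ) := Real.sin_pos_of_pos_of_lt_pi (by linarith) (by linarith)
        nlinarith)
      exact ⟨φ, h1, h2, by linarith, h3⟩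
    · obtain ⟨φ, h1, h2, h3⟩ := hF.exists_zero hc₂ z (show θ ≤ θ + Real.pi by
        linarith [Real.pi_pos]) (by
        refine mul_neg_of_pos_of_neg hpos ?_
        rw [frameNormal_add_pi, inner_neg_left, hzθ]
        have := hD₂.width_pos (hF.normal_ne_zero θ)
        linarith)
      exact ⟨φ, h1, by linarith, h2, h3⟩
  obtain ⟨φ, h1, h2, h3, h4⟩ := key
  obtain ⟨s, hs⟩ := hF.eq_contactPoint_add hD₂ h4
  refine ⟨φ, s, h1, h2, ?_, hs⟩
  rw [hs, hF.inner_normal_contactPoint_add] at hzθ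
  have h5 := hD₂.inner_le_supportFun (frameNormal e f θ)
    (hD₂.contactPoint_mem_self (frameNormal e f φ))
  have h6 : Real.sin (θ - φ) < 0 := Real.sin_neg_of_neg_of_neg_pi_lt (by linarith) (by linarith)
  nlinarith

/-- A boundary point of `L` ahead of `D₂` on a tangent of `D₂` is ahead of `D₁` on a tangent of
`D₁` turned to a larger angle, as long as `D₁` reaches further out than `D₂`. -/
theorem IsFrame.exists_forward_tangent (hF : IsFrame e f) (hL : IsConvexBody L)
    (hD₁ : IsConvexBody D₁) (hD₂ : IsConvexBody D₂) (hc₁ : HasC2SupportFun D₁)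
    (hDL₁ : D₁ ⊆ interior L) (hDL₂ : D₂ ⊆ interior L)
    (h0 : supportFun D₁ e = supportFun D₂ e) {φ s : ℝ} (hφ : φ < 0)
    (hlt : supportFun D₂ (frameNormal e f φ) < supportFun D₁ (frameNormal e f φ)) (hs : 0 < s)
    (hz : contactPoint D₂ (frameNormal e f φ) + s • frameTangent e f φ ∈ frontier L) :
    ∃ θ t : ℝ, φ < θ ∧ θ < 0 ∧ 0 < t ∧
      contactPoint D₂ (frameNormal e f φ) + s • frameTangent e f φ =
        contactPoint D₁ (frameNormal e f θ) + t • frameTangent e f θ := by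
  obtain ⟨v, hv, hvL⟩ := hL.exists_normal hz
  set z := contactPoint D₂ (frameNormal e f φ) + s • frameTangent e f φ with hzdef
  have hzφ : ⟪frameNormal e f φ, z⟫ = supportFun D₂ (frameNormal e f φ) :=
    hF.inner_contactPoint_add hD₂ φ s
  have hv1 : supportFun D₁ v < ⟪v, z⟫ := by
    rw [← hD₁.inner_contactPoint]
    exact hvL _ (hDL₁ (hD₁.contactPoint_mem_self v))
  have hv2 : supportFun D₂ v < ⟪v, z⟫ := by
    rw [← hD₂.inner_contactPoint]
    exact hvL _ (hDL₂ (hD₂.contactPoint_mem_self v))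
  have hvt : 0 < ⟪v, frameTangent e f φ⟫ := by
    have h1 := hD₂.inner_le_supportFun v (hD₂.contactPoint_mem_self (frameNormal e f φ))
    rw [hzdef, inner_add_right, real_inner_smul_right] at hv2
    by_contra hcon
    nlinarith
  obtain ⟨ψ, hψ1, hψ2, rfl⟩ := hF.exists_angle φ hv hvt
  have key : ∃ m, φ < m ∧ m ≤ 0 ∧ m < φ + Real.pi ∧
      supportFun D₁ (frameNormal e f m) < ⟪frameNormal e f m, z⟫ := by
    -- The outer normal of `L` at `z` already separates `z` from `D₁`. If its angle is positive, `e`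
    -- is a positive combination of the normals at `φ` and `ψ`; `z` is level with `D₂` along the
    -- first and strictly beyond it along the second, so `z` is strictly beyond the common tangent.
    by_cases hψ0 : ψ ≤ 0
    · exact ⟨ψ, hψ1, hψ0, hψ2, hv1⟩
    · push Not at hψ0
      refine ⟨0, hφ, le_rfl, by linarith, ?_⟩
      rw [frameNormal_zero, h0, ← hD₂.inner_contactPoint]
      have hS : 0 < Real.sin (ψ - φ) := Real.sin_pos_of_pos_of_lt_pi (by linarith) (by linarith)
      have hα : 0 < Real.sin ψ := Real.sin_pos_of_pos_of_lt_pi hψ0 (by linarith)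
      have hβ : 0 < Real.sin (-φ) := Real.sin_pos_of_pos_of_lt_pi (by linarith) (by linarith)
      have hcomb : Real.sin (ψ - φ) • e =
          Real.sin ψ • frameNormal e f φ + Real.sin (-φ) • frameNormal e f ψ := by
        simp only [frameNormal, Real.sin_sub, Real.sin_neg]
        module
      have hx : ∀ x : Plane, Real.sin (ψ - φ) * ⟪e, x⟫ =
          Real.sin ψ * ⟪frameNormal e f φ, x⟫ + Real.sin (-φ) * ⟪frameNormal e f ψ, x⟫ := by
        intro x
        rw [← real_inner_smul_left, hcomb, inner_add_left, real_inner_smul_left,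
          real_inner_smul_left]
      have hx1 := hx (contactPoint D₂ e)
      have hx2 := hx z
      have h1 := hD₂.inner_le_supportFun (frameNormal e f φ) (hD₂.contactPoint_mem_self e)
      have h2 := hD₂.inner_le_supportFun (frameNormal e f ψ) (hD₂.contactPoint_mem_self e)
      rw [hzφ] at hx2
      have h3 := mul_le_mul_of_nonneg_left h1 hα.le
      have h4 := mul_lt_mul_of_pos_left (h2.trans_lt hv2) hβ
      have h5 : Real.sin (ψ - φ) * ⟪e, contactPoint D₂ e⟫ < Real.sin (ψ - φ) * ⟪e, z⟫ := by
        linarith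
      exact lt_of_mul_lt_mul_left h5 hS.le
  obtain ⟨m, hm1, hm2, hm3, hm4⟩ := key
  obtain ⟨θ, h1, h2, h3⟩ := hF.exists_zero hc₁ z hm1.le
    (mul_neg_of_neg_of_pos (by rw [hzφ]; linarith) (by linarith))
  obtain ⟨t, ht⟩ := hF.eq_contactPoint_add hD₁ h3
  refine ⟨θ, t, h1, by linarith, ?_, ht⟩
  rw [ht, hF.inner_normal_contactPoint_add] at hm4
  have h5 := hD₁.inner_le_supportFun (frameNormal e f m)
    (hD₁.contactPoint_mem_self (frameNormal e f θ))
  have h6 : 0 < Real.sin (m - θ) := Real.sin_pos_of_pos_of_lt_pi (by linarith) (by linarith)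
  by_contra hcon
  nlinarith

/-- Along an outer normal `ψ` of `L` at `z` the point lies beyond `D`, and along `-ψ` it does not.
Some normal in the half-turn before `ψ` therefore supports `D` on a line through `z`, and being
before `ψ` puts `z` ahead of the contact point. -/
theorem IsFrame.exists_tangent_through (hF : IsFrame e f) (hL : IsConvexBody L)
    (hD : IsConvexBody D) (hc : HasC2SupportFun D) (hDL : D ⊆ interior L) (c : ℝ) {z : Plane}
    (hz : z ∈ frontier L) :
    ∃ θ ∈ Ico c (c + 2 * Real.pi), ∃ t : ℝ, 0 < t ∧
      z = contactPoint D (frameNormal e f θ) + t • frameTangent e f θ := by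
  obtain ⟨v, hv, hvL⟩ := hL.exists_normal hz
  have hv1 : supportFun D v < ⟪v, z⟫ := by
    rw [← hD.inner_contactPoint]
    exact hvL _ (hDL (hD.contactPoint_mem_self v))
  obtain ⟨ψ, -, rfl⟩ := hF.exists_angle_mem_Ico 0 hv
  have hneg : frameNormal e f (ψ - Real.pi) = -frameNormal e f ψ := by
    rw [eq_neg_iff_add_eq_zero, ← neg_eq_iff_add_eq_zero, ← frameNormal_add_pi, sub_add_cancel]
  obtain ⟨θ, h1, h2, h3⟩ := hF.exists_zero hc z (show ψ - Real.pi ≤ ψ by linarith [Real.pi_pos])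
    (by
      refine mul_neg_of_neg_of_pos ?_ (by linarith)
      rw [hneg, inner_neg_left]
      have := hD.width_pos (hF.normal_ne_zero ψ)
      linarith)
  obtain ⟨t, ht⟩ := hF.eq_contactPoint_add hD h3
  have ht0 : 0 < t := by
    rw [ht, hF.inner_normal_contactPoint_add] at hv1
    have h5 := hD.inner_le_supportFun (frameNormal e f ψ)
      (hD.contactPoint_mem_self (frameNormal e f θ))
    have h6 : 0 < Real.sin (ψ - θ) := Real.sin_pos_of_pos_of_lt_pi (by linarith) (by linarith)
    by_contra hcon
    nlinarith
  have hper : Function.Periodic (fun x => (frameNormal e f x, frameTangent e f x))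
      (2 * Real.pi) := fun x => by
    simp [frameNormal, frameTangent]
  obtain ⟨y, hy, h⟩ := hper.exists_mem_Ico Real.two_pi_pos θ c
  rw [Prod.mk.injEq] at h
  exact ⟨y, hy, t, ht0, by rw [← h.1, ← h.2]; exact ht⟩

end Tangents

/-! ### Endpoints of tangent chords -/

/-- The endpoint of the chord of `K` tangent to `D` in the direction of the tangent. -/
noncomputable def frontEnd (K D : Set Plane) (e f : Plane) (θ : ℝ) : Plane :=
  contactPoint D (frameNormal e f θ) +
    chordRadial K D (frameTangent e f θ) (frameNormal e f θ) • frameTangent e f θ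

/-- The endpoint of the chord of `K` tangent to `D` in the direction opposite to the tangent. -/
noncomputable def backEnd (K D : Set Plane) (e f : Plane) (θ : ℝ) : Plane :=
  contactPoint D (frameNormal e f θ) +
    (-chordRadial K D (-frameTangent e f θ) (frameNormal e f θ)) • frameTangent e f θ

section Chords

variable {e f : Plane} {K D : Set Plane}

theorem chordRadial_pos (hF : IsFrame e f) (hK : IsConvexBody K) (hD : IsConvexBody D)
    (hDK : D ⊆ interior K) (θ : ℝ) :
    0 < chordRadial K D (frameTangent e f θ) (frameNormal e f θ) :=
  hK.radialAt_pos (hDK (hD.contactPoint_mem_self _)) (hF.tangent_ne_zero θ)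

theorem chordRadial_neg_pos (hF : IsFrame e f) (hK : IsConvexBody K) (hD : IsConvexBody D)
    (hDK : D ⊆ interior K) (θ : ℝ) :
    0 < chordRadial K D (-frameTangent e f θ) (frameNormal e f θ) :=
  hK.radialAt_pos (hDK (hD.contactPoint_mem_self _)) (neg_ne_zero.2 (hF.tangent_ne_zero θ))

theorem add_smul_mem_frontier_iff_pos (hF : IsFrame e f) (hK : IsConvexBody K)
    (hD : IsConvexBody D) (hDK : D ⊆ interior K) (θ : ℝ) {t : ℝ} (ht : 0 < t) :
    contactPoint D (frameNormal e f θ) + t • frameTangent e f θ ∈ frontier K ↔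
      t = chordRadial K D (frameTangent e f θ) (frameNormal e f θ) :=
  hK.add_smul_mem_frontier_iff (hDK (hD.contactPoint_mem_self _)) (hF.tangent_ne_zero θ) ht

theorem add_smul_mem_frontier_iff_neg (hF : IsFrame e f) (hK : IsConvexBody K)
    (hD : IsConvexBody D) (hDK : D ⊆ interior K) (θ : ℝ) {t : ℝ} (ht : t < 0) :
    contactPoint D (frameNormal e f θ) + t • frameTangent e f θ ∈ frontier K ↔
      t = -chordRadial K D (-frameTangent e f θ) (frameNormal e f θ) := by
  have h := hK.add_smul_mem_frontier_iff
    (hDK (hD.contactPoint_mem_self (frameNormal e f θ)))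
    (neg_ne_zero.2 (hF.tangent_ne_zero θ)) (neg_pos.2 ht)
  rw [neg_smul_neg] at h
  rw [h, neg_eq_iff_eq_neg]
  rfl

theorem frontEnd_mem (hF : IsFrame e f) (hK : IsConvexBody K) (hD : IsConvexBody D)
    (hDK : D ⊆ interior K) (θ : ℝ) : frontEnd K D e f θ ∈ frontier K :=
  (add_smul_mem_frontier_iff_pos hF hK hD hDK θ (chordRadial_pos hF hK hD hDK θ)).2 rfl

theorem backEnd_mem (hF : IsFrame e f) (hK : IsConvexBody K) (hD : IsConvexBody D)
    (hDK : D ⊆ interior K) (θ : ℝ) : backEnd K D e f θ ∈ frontier K :=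
  (add_smul_mem_frontier_iff_neg hF hK hD hDK θ
    (neg_lt_zero.2 (chordRadial_neg_pos hF hK hD hDK θ))).2 rfl

theorem inner_frontEnd (hF : IsFrame e f) (hD : IsConvexBody D) (θ : ℝ) :
    ⟪frameNormal e f θ, frontEnd K D e f θ⟫ = supportFun D (frameNormal e f θ) :=
  hF.inner_contactPoint_add hD θ _

theorem inner_backEnd (hF : IsFrame e f) (hD : IsConvexBody D) (θ : ℝ) :
    ⟪frameNormal e f θ, backEnd K D e f θ⟫ = supportFun D (frameNormal e f θ) :=
  hF.inner_contactPoint_add hD θ _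

theorem eq_frontEnd_or_eq_backEnd (hF : IsFrame e f) (hK : IsConvexBody K) (hD : IsConvexBody D)
    (hDK : D ⊆ interior K) {θ : ℝ} {z : Plane} (hz : z ∈ frontier K)
    (hzθ : ⟪frameNormal e f θ, z⟫ = supportFun D (frameNormal e f θ)) :
    z = frontEnd K D e f θ ∨ z = backEnd K D e f θ := by
  obtain ⟨t, rfl⟩ := hF.eq_contactPoint_add hD hzθ
  rcases lt_trichotomy t 0 with h | h | h
  · right
    rw [add_smul_mem_frontier_iff_neg hF hK hD hDK θ h] at hz
    rw [hz, backEnd]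
  · rw [h, zero_smul, add_zero] at hz
    exact absurd (hDK (hD.contactPoint_mem_self _)) hz.2
  · left
    rw [add_smul_mem_frontier_iff_pos hF hK hD hDK θ h] at hz
    rw [hz, frontEnd]

theorem continuous_chordRadial (hF : IsFrame e f) (hK : IsConvexBody K) (hD : IsConvexBody D)
    (hc : HasC2SupportFun D) (hDK : D ⊆ interior K) :
    Continuous fun θ => chordRadial K D (frameTangent e f θ) (frameNormal e f θ) :=
  continuous_iff_continuousAt.2 fun θ => hK.tendsto_radialAt
    (hDK (hD.contactPoint_mem_self _)) (hF.tangent_ne_zero θ)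
    ((hF.continuous_contactPoint hD hc).tendsto θ) ((continuous_frameTangent e f).tendsto θ)

theorem continuous_chordRadial_neg (hF : IsFrame e f) (hK : IsConvexBody K) (hD : IsConvexBody D)
    (hc : HasC2SupportFun D) (hDK : D ⊆ interior K) :
    Continuous fun θ => chordRadial K D (-frameTangent e f θ) (frameNormal e f θ) :=
  continuous_iff_continuousAt.2 fun θ => hK.tendsto_radialAt
    (hDK (hD.contactPoint_mem_self _)) (neg_ne_zero.2 (hF.tangent_ne_zero θ))
    ((hF.continuous_contactPoint hD hc).tendsto θ) ((continuous_frameTangent e f).neg.tendsto θ)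

theorem continuous_frontEnd (hF : IsFrame e f) (hK : IsConvexBody K) (hD : IsConvexBody D)
    (hc : HasC2SupportFun D) (hDK : D ⊆ interior K) : Continuous (frontEnd K D e f) :=
  (hF.continuous_contactPoint hD hc).add
    ((continuous_chordRadial hF hK hD hc hDK).smul (continuous_frameTangent e f))

theorem continuous_backEnd (hF : IsFrame e f) (hK : IsConvexBody K) (hD : IsConvexBody D)
    (hc : HasC2SupportFun D) (hDK : D ⊆ interior K) : Continuous (backEnd K D e f) :=
  (hF.continuous_contactPoint hD hc).add
    ((continuous_chordRadial_neg hF hK hD hc hDK).neg.smul (continuous_frameTangent e f))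

theorem inner_left_contactPoint_add (hF : IsFrame e f) (θ t : ℝ) :
    ⟪e, contactPoint D (frameNormal e f θ) + t • frameTangent e f θ⟫ =
      ⟪e, contactPoint D (frameNormal e f θ)⟫ - t * Real.sin θ := by
  rw [inner_add_right, real_inner_smul_right, hF.inner_left_tangent]
  ring

/-- Near the line with normal `e`, the contact point leaves that line slower than the angle. -/
theorem tendsto_height_contactPoint (hF : IsFrame e f) (hD : IsConvexBody D)
    (hc : HasC2SupportFun D) {ι : Type*} {l : Filter ι} {θ : ι → ℝ} (hθ : Tendsto θ l (𝓝 0)) :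
    Tendsto (fun n => (⟪e, contactPoint D (frameNormal e f (θ n))⟫ - supportFun D e) /
      Real.sin (θ n)) l (𝓝 0) := by
  have hp := ((hF.continuous_contactPoint hD hc).tendsto 0).comp hθ
  have hf : Tendsto (fun _ : ι => f) l (𝓝 f) := tendsto_const_nhds
  have hΔ : Tendsto (fun n => |⟪f, contactPoint D (frameNormal e f (θ n)) -
      contactPoint D (frameNormal e f 0)⟫| / Real.cos (θ n)) l (𝓝 0) := by
    have h1 := (Tendsto.inner (𝕜 := ℝ) hf
      (hp.sub_const (contactPoint D (frameNormal e f 0)))).abs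
    have h2 := h1.div ((Real.continuous_cos.tendsto 0).comp hθ) (by simp)
    simp only [sub_self, inner_zero_right, abs_zero, zero_div] at h2
    exact h2
  have hcos : ∀ᶠ n in l, 0 < Real.cos (θ n) :=
    ((Real.continuous_cos.tendsto 0).comp hθ).eventually_const_lt (by simp)
  refine squeeze_zero_norm' ?_ hΔ
  filter_upwards [hcos] with n hn
  set q := contactPoint D (frameNormal e f (θ n)) with hq
  set q₀ := contactPoint D (frameNormal e f 0) with hq₀
  have h0 : ⟪e, q₀⟫ = supportFun D e := by
    have := hD.inner_contactPoint (frameNormal e f 0)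
    rwa [frameNormal_zero, ← frameNormal_zero e f, ← hq₀, frameNormal_zero] at this
  have h1 : ⟪e, q⟫ ≤ supportFun D e := hD.inner_le_supportFun e (hD.contactPoint_mem_self _)
  -- The optimality of `q` at angle `θ n` and of `q₀` at angle `0` together bound the drop of `q`
  -- below the line by the tangent of the angle times the displacement along `f`, which tends to
  -- `0`.
  have h2 : ⟪frameNormal e f (θ n), q₀⟫ ≤ ⟪frameNormal e f (θ n), q⟫ := by
    rw [hq, hD.inner_contactPoint]
    exact hD.inner_le_supportFun _ (hD.contactPoint_mem_self _)
  simp only [frameNormal, inner_add_left, real_inner_smul_left] at h2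
  rw [h0] at h2
  rw [inner_sub_right]
  rw [Real.norm_eq_abs, abs_div, abs_sub_comm ⟪e, q⟫, abs_of_nonneg (sub_nonneg.2 h1)]
  -- No sign or nonvanishing of `θ n` is assumed; for a zero sine the quotient is `0` by convention.
  rcases eq_or_ne (Real.sin (θ n)) 0 with hs | hs
  · rw [hs, abs_zero, div_zero]
    positivity
  · rw [div_le_div_iff₀ (abs_pos.2 hs) hn]
    have h3 : Real.sin (θ n) * (⟪f, q⟫ - ⟪f, q₀⟫) ≤ |⟪f, q⟫ - ⟪f, q₀⟫| * |Real.sin (θ n)| := by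
      rw [← abs_mul, mul_comm]
      exact le_abs_self _
    nlinarith

/-- The boundary of a convex body is Lipschitz over a line transversal to it. -/
theorem IsConvexBody.exists_lipschitz (hF : IsFrame e f) (hK : IsConvexBody K) {p : Plane}
    (hp : p ∈ interior K) {a : ℝ} (ha : a ≠ 0) :
    ∃ M η : ℝ, 0 < M ∧ 0 < η ∧ ∀ x ∈ frontier K, ∀ y ∈ frontier K,
      dist x (p + a • f) < η → dist y (p + a • f) < η → |⟪f, x - y⟫| ≤ M * |⟪e, x - y⟫| := by
  obtain ⟨ρ, hρ, hball⟩ := Metric.mem_nhds_iff.1 (isOpen_interior.mem_nhds hp)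
  have ha' : 0 < |a| := abs_pos.2 ha
  have key : ∀ x ∈ frontier K, ∀ y ∈ frontier K,
      dist x (p + a • f) < min (ρ / 2) (|a| / 2) → dist y (p + a • f) < min (ρ / 2) (|a| / 2) →
      0 < ⟪f, y - x⟫ / a → |⟪f, y - x⟫| ≤ 2 * |a| / ρ * |⟪e, y - x⟫| := by
    intro x hx y hy hxA hyA hpos
    by_contra! hcon
    set α := ⟪f, y - x⟫ with hα
    set β := ⟪e, y - x⟫ with hβ
    set τ := α / a with hτ
    have hα0 : α ≠ 0 := by
      intro h
      rw [hτ, h, zero_div] at hpos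
      exact lt_irrefl _ hpos
    have hτ1 : τ < 1 := by
      have h1 : dist y x < |a| := by
        have h2 := dist_triangle_right y x (p + a • f)
        have h3 := hxA.trans_le (min_le_right _ _)
        have h4 := hyA.trans_le (min_le_right _ _)
        linarith
      have h2 : |α| ≤ dist y x := by
        have := abs_real_inner_le_norm f (y - x)
        rwa [hF.norm_right, one_mul, ← dist_eq_norm] at this
      have h3 : |τ| < 1 := by
        rw [hτ, abs_div, div_lt_one ha']
        linarith
      exact (abs_lt.1 h3).2
    have hyx : y - x = β • e + α • f := hF.eq_add (y - x)
    -- Extending the segment from `y` through `x` until it has moved by `-a` along `f` lands near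
    -- `p`, since a steep segment drifts little along `e`. Then `q` is interior and `x` lies
    -- strictly between `q` and the point `y` of `K`, so `x` would be interior.
    set q := y - τ⁻¹ • (y - x) with hq
    have hqp : q ∈ interior K := by
      apply hball
      rw [Metric.mem_ball, dist_eq_norm]
      have h1 : q - p = (y - (p + a • f)) - (τ⁻¹ * β) • e := by
        have h2 : τ⁻¹ * α = a := by
          rw [hτ, inv_div, div_mul_cancel₀ _ hα0]
        rw [hq, hyx, smul_add, smul_smul, smul_smul, h2]
        abel
      have h3 : ‖(τ⁻¹ * β) • e‖ < ρ / 2 := by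
        rw [norm_smul, hF.norm_left, mul_one, Real.norm_eq_abs, abs_mul, hτ, inv_div, abs_div,
          div_mul_eq_mul_div, div_lt_iff₀ (abs_pos.2 hα0)]
        have h4 := mul_lt_mul_of_pos_right hcon (half_pos hρ)
        have h5 : 2 * |a| / ρ * |β| * (ρ / 2) = |a| * |β| := by
          field_simp
        linarith
      rw [h1]
      have h6 := norm_sub_le (y - (p + a • f)) ((τ⁻¹ * β) • e)
      have h7 := hyA.trans_le (min_le_left _ _)
      rw [dist_eq_norm] at h7
      linarith
    have hxi : x ∈ interior K := by
      have hyK : y ∈ K := hK.isCompact.isClosed.frontier_subset hy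
      have h1 := hK.convex.combo_interior_self_mem_interior hqp hyK hpos
        (show 0 ≤ 1 - τ by linarith) (by ring)
      have h2 : τ • q + (1 - τ) • y = x := by
        rw [hq, smul_sub, smul_smul, mul_inv_cancel₀ hpos.ne', one_smul]
        module
      rwa [h2] at h1
    exact hx.2 hxi
  refine ⟨2 * |a| / ρ, min (ρ / 2) (|a| / 2), by positivity, by positivity,
    fun x hx y hy hxA hyA => ?_⟩
  have hsw : ∀ v : Plane, |⟪v, x - y⟫| = |⟪v, y - x⟫| := fun v => by
    rw [← abs_neg, ← inner_neg_right, neg_sub]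
  rcases lt_trichotomy (⟪f, y - x⟫ / a) 0 with h | h | h
  · refine key y hy x hx hyA hxA ?_
    rw [← neg_sub y x, inner_neg_right, neg_div]
    linarith
  · rcases div_eq_zero_iff.1 h with h | h
    · rw [hsw f, h, abs_zero]
      positivity
    · exact absurd h ha
  · rw [hsw, hsw]
    exact key x hx y hy hxA hyA h

end Chords

/-! ### Limits of ratios -/

/-- After division by `d n`, the right side is `M` times terms with small sines, so the quotient `r`
satisfies `cos θ - r cos φ → 0` once `r` is known to be bounded; a first crude use of the same
inequality gives that bound. -/
theorem tendsto_ratio_of_lipschitz {d d' θ φ : ℕ → ℝ} {M : ℝ} (hM : 0 < M) (hd : ∀ n, d n ≠ 0)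
    (hθ : Tendsto θ atTop (𝓝 0)) (hφ : Tendsto φ atTop (𝓝 0))
    (h : ∀ᶠ n in atTop, |d n * Real.cos (θ n) - d' n * Real.cos (φ n)| ≤
      M * |d n * Real.sin (θ n) - d' n * Real.sin (φ n)|) :
    Tendsto (fun n => d' n / d n) atTop (𝓝 1) := by
  have hcθ : Tendsto (fun n => Real.cos (θ n)) atTop (𝓝 1) := by
    have := (Real.continuous_cos.tendsto 0).comp hθ
    rwa [Real.cos_zero] at this
  have hcφ : Tendsto (fun n => Real.cos (φ n)) atTop (𝓝 1) := by
    have := (Real.continuous_cos.tendsto 0).comp hφ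
    rwa [Real.cos_zero] at this
  have hsθ : Tendsto (fun n => |Real.sin (θ n)|) atTop (𝓝 0) := by
    simpa using ((Real.continuous_sin.tendsto 0).comp hθ).abs
  have hsφ : Tendsto (fun n => |Real.sin (φ n)|) atTop (𝓝 0) := by
    simpa using ((Real.continuous_sin.tendsto 0).comp hφ).abs
  have hq : ∀ᶠ n in atTop, |Real.cos (θ n) - d' n / d n * Real.cos (φ n)| ≤
      M * (|Real.sin (θ n)| + |d' n / d n| * |Real.sin (φ n)|) := by
    filter_upwards [h] with n hn
    have hd0 := abs_pos.2 (hd n)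
    have h1 : d n * Real.cos (θ n) - d' n * Real.cos (φ n) =
        d n * (Real.cos (θ n) - d' n / d n * Real.cos (φ n)) := by
      have := hd n
      field_simp
    have h2 : d n * Real.sin (θ n) - d' n * Real.sin (φ n) =
        d n * (Real.sin (θ n) - d' n / d n * Real.sin (φ n)) := by
      have := hd n
      field_simp
    rw [h1, h2, abs_mul, abs_mul, mul_left_comm] at hn
    refine (le_of_mul_le_mul_left hn hd0).trans (mul_le_mul_of_nonneg_left ?_ hM.le)
    rw [← abs_mul]
    exact abs_sub _ _
  have hbd : ∀ᶠ n in atTop, |d' n / d n| ≤ 2 := by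
    have e1 : ∀ᶠ n in atTop, 3 / 4 < Real.cos (φ n) - M * |Real.sin (φ n)| := by
      have := hcφ.sub (hsφ.const_mul M)
      exact this.eventually_const_lt (by norm_num)
    have e2 : ∀ᶠ n in atTop, |Real.cos (θ n)| + M * |Real.sin (θ n)| < 3 / 2 := by
      have := hcθ.abs.add (hsθ.const_mul M)
      exact this.eventually_lt_const (by norm_num)
    filter_upwards [hq, e1, e2] with n h1 h2 h3
    have h4 : |d' n / d n| * Real.cos (φ n) ≤ |d' n / d n * Real.cos (φ n)| := by
      rw [abs_mul]
      exact mul_le_mul_of_nonneg_left (le_abs_self _) (abs_nonneg _)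
    have h5 : |d' n / d n * Real.cos (φ n)| - |Real.cos (θ n)| ≤
        |Real.cos (θ n) - d' n / d n * Real.cos (φ n)| := by
      rw [abs_sub_comm]
      exact abs_sub_abs_le_abs_sub _ _
    have h6 : |d' n / d n| * (Real.cos (φ n) - M * |Real.sin (φ n)|) < 3 / 2 := by
      linarith
    have h7 := mul_le_mul_of_nonneg_left h2.le (abs_nonneg (d' n / d n))
    linarith
  have hz : Tendsto (fun n => Real.cos (θ n) - d' n / d n * Real.cos (φ n)) atTop (𝓝 0) := by
    have hb : Tendsto (fun n => M * (|Real.sin (θ n)| + 2 * |Real.sin (φ n)|)) atTop (𝓝 0) := by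
      simpa using (hsθ.add (hsφ.const_mul 2)).const_mul M
    refine squeeze_zero_norm' ?_ hb
    filter_upwards [hq, hbd] with n h1 h2
    refine h1.trans (mul_le_mul_of_nonneg_left (add_le_add_right ?_ _) hM.le)
    exact mul_le_mul_of_nonneg_right h2 (abs_nonneg _)
  have hfin := (hcθ.sub hz).div hcφ one_ne_zero
  rw [sub_zero, div_one] at hfin
  refine hfin.congr' ?_
  filter_upwards [hcφ.eventually_const_lt (show (0 : ℝ) < 1 by norm_num)] with n hn
  simp only [Pi.div_apply, sub_sub_cancel]
  rw [mul_div_assoc, div_self hn.ne', mul_one]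

/-- Difference quotients of `x ^ i` at two moving points near `c` tend to `i * c ^ (i - 1)`; strict
differentiability is what allows both points to move. Equal differences of powers then give gaps in
the inverse ratio of the slopes. -/
theorem tendsto_ratio_of_rpow {s t s' t' : ℕ → ℝ} {a b i : ℝ} (ha : 0 < a) (hb : 0 < b)
    (hi : 0 < i) (hs : Tendsto s atTop (𝓝 a)) (ht : Tendsto t atTop (𝓝 a))
    (hs' : Tendsto s' atTop (𝓝 b)) (ht' : Tendsto t' atTop (𝓝 b)) (hst : ∀ n, s n ≠ t n)
    (hst' : ∀ n, s' n ≠ t' n) (h : ∀ n, |s n ^ i - t n ^ i| = |s' n ^ i - t' n ^ i|) :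
    Tendsto (fun n => |s' n - t' n| / |s n - t n|) atTop (𝓝 ((a / b) ^ (i - 1))) := by
  have slope : ∀ {x y : ℕ → ℝ} {c : ℝ}, 0 < c → Tendsto x atTop (𝓝 c) → Tendsto y atTop (𝓝 c) →
      (∀ n, x n ≠ y n) →
      Tendsto (fun n => |x n ^ i - y n ^ i| / |x n - y n|) atTop (𝓝 (i * c ^ (i - 1))) := by
    intro x y c hc hx hy hxy
    have hd := Real.hasStrictDerivAt_rpow_const (p := i) (Or.inl hc.ne')
    have h1 := hd.isLittleO.comp_tendsto (hx.prodMk_nhds hy)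
    have h2 := h1.tendsto_div_nhds_zero
    have h3 := (h2.add_const (i * c ^ (i - 1))).abs
    rw [zero_add, abs_of_pos (by positivity)] at h3
    refine h3.congr fun n => ?_
    have := sub_ne_zero.2 (hxy n)
    simp only [Function.comp_apply, ContinuousLinearMap.toSpanSingleton_apply, smul_eq_mul]
    rw [← abs_div]
    congr 1
    field_simp
    ring
  have h1 := (slope ha hs ht hst).div (slope hb hs' ht' hst') (by positivity)
  have h2 : i * a ^ (i - 1) / (i * b ^ (i - 1)) = (a / b) ^ (i - 1) := by
    rw [Real.div_rpow ha.le hb.le]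
    field_simp
  rw [h2] at h1
  refine h1.congr' ?_
  have hne : ∀ᶠ n in atTop, |s n ^ i - t n ^ i| / |s n - t n| ≠ 0 :=
    (slope ha hs ht hst).eventually_ne (by positivity)
  filter_upwards [hne] with n hn
  simp only [Pi.div_apply]
  rw [← h n]
  have h3 : |s n ^ i - t n ^ i| ≠ 0 := fun h0 => hn (by rw [h0, zero_div])
  have h4 := abs_pos.2 (sub_ne_zero.2 (hst n))
  have h5 := abs_pos.2 (sub_ne_zero.2 (hst' n))
  field_simp

theorem not_bounded_of_ratio_tendsto {q : ℕ → ℝ} {κ C : ℝ} (hκ : 1 < κ)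
    (hq : ∀ᶠ n in atTop, 0 < q n) (hC : ∀ᶠ n in atTop, q n ≤ C)
    (h : Tendsto (fun n => q (n + 1) / q n) atTop (𝓝 κ)) : False := by
  obtain ⟨r, hr1, hr2⟩ := exists_between hκ
  obtain ⟨N, hN⟩ := eventually_atTop.1 (hq.and (hC.and (h.eventually_const_lt hr2)))
  have hpow : ∀ k, r ^ k * q N ≤ q (N + k) := by
    intro k
    induction k with
    | zero => simp
    | succ k ih =>
      obtain ⟨h1, -, h3⟩ := hN (N + k) (Nat.le_add_right N k)
      rw [lt_div_iff₀ h1] at h3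
      calc r ^ (k + 1) * q N = r * (r ^ k * q N) := by ring
        _ ≤ r * q (N + k) := mul_le_mul_of_nonneg_left ih (by linarith)
        _ ≤ q (N + (k + 1)) := h3.le
  have hN0 := (hN N le_rfl).1
  obtain ⟨k, hk⟩ := pow_unbounded_of_one_lt (C / q N) hr1
  rw [div_lt_iff₀ hN0] at hk
  have := (hN (N + k) (Nat.le_add_right N k)).2.1
  linarith [hpow k]

/-! ### Chords common to two bodies -/

/-- `D` lies inside `K` and `L`, and on each tangent of `D` the two ends of the chords of `K` and
`L` differ by the same amount, measured through `i`-th powers of distances to `D`. -/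
structure IsChordEquivalent (K L D : Set Plane) (i : ℝ) : Prop where
  left : IsConvexBody K
  right : IsConvexBody L
  body : IsConvexBody D
  c2 : HasC2SupportFun D
  subset_left : D ⊆ interior K
  subset_right : D ⊆ interior L
  abs_sub_eq : ∀ ξ u : Plane, ‖ξ‖ = 1 → ‖u‖ = 1 → ⟪u, ξ⟫ = 0 →
    |chordRadial K D u ξ ^ i - chordRadial L D u ξ ^ i| =
      |chordRadial K D (-u) ξ ^ i - chordRadial L D (-u) ξ ^ i|

/-- The endpoints of the chord of `L` on the supporting line of `D` with normal `v` are
boundary points of `K`. -/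
def HasCommonChord (K L D : Set Plane) (v : Plane) : Prop :=
  ∀ z ∈ frontier L, ⟪v, z⟫ = supportFun D v → z ∈ frontier K

namespace IsChordEquivalent

variable {K L D D₁ D₂ : Set Plane} {e f : Plane} {i : ℝ}

theorem abs_sub_eq_frame (h : IsChordEquivalent K L D i) (hF : IsFrame e f) (θ : ℝ) :
    |chordRadial K D (frameTangent e f θ) (frameNormal e f θ) ^ i -
        chordRadial L D (frameTangent e f θ) (frameNormal e f θ) ^ i| =
      |chordRadial K D (-frameTangent e f θ) (frameNormal e f θ) ^ i -
        chordRadial L D (-frameTangent e f θ) (frameNormal e f θ) ^ i| :=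
  h.abs_sub_eq _ _ (hF.norm_normal θ) (hF.norm_tangent θ) (hF.isFrame_rotate θ).inner_eq_zero'

theorem frontEnd_mem_iff (h : IsChordEquivalent K L D i) (hF : IsFrame e f) (θ : ℝ) :
    frontEnd L D e f θ ∈ frontier K ↔
      chordRadial K D (frameTangent e f θ) (frameNormal e f θ) =
        chordRadial L D (frameTangent e f θ) (frameNormal e f θ) := by
  rw [frontEnd, add_smul_mem_frontier_iff_pos hF h.left h.body h.subset_left θ
    (chordRadial_pos hF h.right h.body h.subset_right θ), eq_comm]

theorem backEnd_mem_iff (h : IsChordEquivalent K L D i) (hF : IsFrame e f) (θ : ℝ) :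
    backEnd L D e f θ ∈ frontier K ↔
      chordRadial K D (-frameTangent e f θ) (frameNormal e f θ) =
        chordRadial L D (-frameTangent e f θ) (frameNormal e f θ) := by
  rw [backEnd, add_smul_mem_frontier_iff_neg hF h.left h.body h.subset_left θ
    (neg_lt_zero.2 (chordRadial_neg_pos hF h.right h.body h.subset_right θ)), neg_inj, eq_comm]

/-- A gap of `i`-th powers vanishes exactly when the gap of radii does, and the two power gaps have
equal absolute values. This carries coincidence of the boundaries across a chord. -/
theorem frontEnd_mem_iff_backEnd_mem (h : IsChordEquivalent K L D i) (hi : 0 < i)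
    (hF : IsFrame e f) (θ : ℝ) :
    frontEnd L D e f θ ∈ frontier K ↔ backEnd L D e f θ ∈ frontier K := by
  rw [h.frontEnd_mem_iff hF, h.backEnd_mem_iff hF,
    ← Real.rpow_left_inj (chordRadial_pos hF h.left h.body h.subset_left θ).le
      (chordRadial_pos hF h.right h.body h.subset_right θ).le hi.ne',
    ← Real.rpow_left_inj (chordRadial_neg_pos hF h.left h.body h.subset_left θ).le
      (chordRadial_neg_pos hF h.right h.body h.subset_right θ).le hi.ne',
    ← sub_eq_zero, ← abs_eq_zero, h.abs_sub_eq_frame hF, abs_eq_zero, sub_eq_zero]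

/-- The left side does not mention the second frame vector, so results can be transferred to the
reflected frame `(e, -f)`. -/
theorem hasCommonChord_iff (h : IsChordEquivalent K L D i) (hi : 0 < i)
    (hF : IsFrame e f) (θ : ℝ) :
    HasCommonChord K L D (frameNormal e f θ) ↔ frontEnd L D e f θ ∈ frontier K := by
  refine ⟨fun hg => hg _ (frontEnd_mem hF h.right h.body h.subset_right θ)
    (inner_frontEnd hF h.body θ), fun hg z hz hzθ => ?_⟩
  rcases eq_frontEnd_or_eq_backEnd hF h.right h.body h.subset_right hz hzθ with rfl | rfl
  · exact hg
  · exact (h.frontEnd_mem_iff_backEnd_mem hi hF θ).1 hg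

end IsChordEquivalent

/-! ### Alternating tangent chords -/

section Sequence

variable {K L D D₁ D₂ : Set Plane} {e f : Plane} {i c : ℝ}

theorem exists_backEnd_eq (hF : IsFrame e f) (hL : IsConvexBody L)
    (hD₁ : IsConvexBody D₁) (hD₂ : IsConvexBody D₂) (hc₂ : HasC2SupportFun D₂)
    (hDL₁ : D₁ ⊆ interior L) (hDL₂ : D₂ ⊆ interior L)
    (h0 : supportFun D₁ e = supportFun D₂ e) {θ : ℝ} (hθ : θ < 0)
    (hlt : supportFun D₂ (frameNormal e f θ) < supportFun D₁ (frameNormal e f θ)) :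
    ∃ φ, θ < φ ∧ φ < 0 ∧ backEnd L D₁ e f θ = backEnd L D₂ e f φ := by
  obtain ⟨φ, s, h1, h2, h3, h4⟩ := hF.exists_backward_tangent hD₁ hD₂ hc₂ h0 hθ hlt
    (neg_lt_zero.2 (chordRadial_neg_pos hF hL hD₁ hDL₁ θ))
  refine ⟨φ, h1, h2, ?_⟩
  have h5 := backEnd_mem hF hL hD₁ hDL₁ θ
  rw [backEnd, h4] at h5 ⊢
  rw [add_smul_mem_frontier_iff_neg hF hL hD₂ hDL₂ φ h3] at h5
  rw [backEnd, h5]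

theorem exists_frontEnd_eq (hF : IsFrame e f) (hL : IsConvexBody L)
    (hD₁ : IsConvexBody D₁) (hD₂ : IsConvexBody D₂) (hc₁ : HasC2SupportFun D₁)
    (hDL₁ : D₁ ⊆ interior L) (hDL₂ : D₂ ⊆ interior L)
    (h0 : supportFun D₁ e = supportFun D₂ e) {φ : ℝ} (hφ : φ < 0)
    (hlt : supportFun D₂ (frameNormal e f φ) < supportFun D₁ (frameNormal e f φ)) :
    ∃ θ, φ < θ ∧ θ < 0 ∧ frontEnd L D₂ e f φ = frontEnd L D₁ e f θ := by
  have h5 := frontEnd_mem hF hL hD₂ hDL₂ φ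
  obtain ⟨θ, t, h1, h2, h3, h4⟩ := hF.exists_forward_tangent hL hD₁ hD₂ hc₁ hDL₁ hDL₂ h0 hφ hlt
    (chordRadial_pos hF hL hD₂ hDL₂ φ) h5
  refine ⟨θ, h1, h2, ?_⟩
  rw [frontEnd, h4] at h5 ⊢
  rw [add_smul_mem_frontier_iff_pos hF hL hD₁ hDL₁ θ h3] at h5
  rw [frontEnd, h5]

/-- Passing alternately along tangent chords of `D₁` and `D₂` leads towards their common
tangent. -/
theorem exists_alternating_chords (hF : IsFrame e f) (hL : IsConvexBody L)
    (hD₁ : IsConvexBody D₁) (hD₂ : IsConvexBody D₂) (hc₁ : HasC2SupportFun D₁)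
    (hc₂ : HasC2SupportFun D₂) (hDL₁ : D₁ ⊆ interior L) (hDL₂ : D₂ ⊆ interior L)
    (h0 : supportFun D₁ e = supportFun D₂ e)
    (hlt : ∀ θ, -c < θ → θ < 0 →
      supportFun D₂ (frameNormal e f θ) < supportFun D₁ (frameNormal e f θ))
    {θ₀ : ℝ} (hθ₀ : -c < θ₀) (hθ₀' : θ₀ < 0) :
    ∃ θ φ : ℕ → ℝ, θ 0 = θ₀ ∧ (∀ n, θ n < 0) ∧ (∀ n, φ n < 0) ∧ Tendsto θ atTop (𝓝 0) ∧
      Tendsto φ atTop (𝓝 0) ∧ (∀ n, backEnd L D₁ e f (θ n) = backEnd L D₂ e f (φ n)) ∧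
      ∀ n, frontEnd L D₂ e f (φ n) = frontEnd L D₁ e f (θ (n + 1)) := by
  have step1 : ∀ θ : Ioo (-c) 0, ∃ φ : Ioo (-c) 0, θ.1 < φ ∧
      backEnd L D₁ e f θ = backEnd L D₂ e f φ := by
    rintro ⟨θ, h1, h2⟩
    obtain ⟨φ, h3, h4, h5⟩ := exists_backEnd_eq hF hL hD₁ hD₂ hc₂ hDL₁ hDL₂ h0 h2 (hlt θ h1 h2)
    exact ⟨⟨φ, h1.trans h3, h4⟩, h3, h5⟩
  have step2 : ∀ φ : Ioo (-c) 0, ∃ θ : Ioo (-c) 0, φ.1 < θ ∧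
      frontEnd L D₂ e f φ = frontEnd L D₁ e f θ := by
    rintro ⟨θ, h1, h2⟩
    obtain ⟨φ, h3, h4, h5⟩ := exists_frontEnd_eq hF hL hD₁ hD₂ hc₁ hDL₁ hDL₂ h0 h2 (hlt θ h1 h2)
    exact ⟨⟨φ, h1.trans h3, h4⟩, h3, h5⟩
  choose P hP1 hP2 using step1
  choose Q hQ1 hQ2 using step2
  set x : ℕ → Ioo (-c) 0 := fun n => (fun y => Q (P y))^[n] ⟨θ₀, hθ₀, hθ₀'⟩ with hx
  have hxs : ∀ n, x (n + 1) = Q (P (x n)) := fun n => by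
    simp only [hx, Function.iterate_succ_apply']
  have hmono : Monotone fun n => (x n).1 := monotone_nat_of_le_succ fun n => by
    rw [hxs]
    exact ((hP1 _).trans (hQ1 _)).le
  have hbdd : BddAbove (range fun n => (x n).1) := ⟨0, by
    rintro _ ⟨n, rfl⟩
    exact (x n).2.2.le⟩
  obtain ⟨ℓ, hℓ⟩ : ∃ ℓ, Tendsto (fun n => (x n).1) atTop (𝓝 ℓ) :=
    ⟨_, tendsto_atTop_ciSup hmono hbdd⟩
  have hφ : Tendsto (fun n => (P (x n)).1) atTop (𝓝 ℓ) := by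
    refine tendsto_of_tendsto_of_tendsto_of_le_of_le hℓ (hℓ.comp (tendsto_add_atTop_nat 1))
      (fun n => (hP1 _).le) fun n => ?_
    simp only [Function.comp_apply, hxs]
    exact (hQ1 _).le
  have hℓ0 : ℓ ≤ 0 := le_of_tendsto' hℓ fun n => (x n).2.2.le
  have hℓc : θ₀ ≤ ℓ := ge_of_tendsto' hℓ fun n => hmono (Nat.zero_le n)
  have hb1 := ((continuous_backEnd hF hL hD₁ hc₁ hDL₁).tendsto ℓ).comp hℓ
  have hb2 := ((continuous_backEnd hF hL hD₂ hc₂ hDL₂).tendsto ℓ).comp hφ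
  have hbe : backEnd L D₁ e f ℓ = backEnd L D₂ e f ℓ :=
    tendsto_nhds_unique hb1 (hb2.congr fun n => (hP2 (x n)).symm)
  -- At the limit angle the two tangents have the same normal and share a back end, so the support
  -- values agree; `hlt` rules this out before `0`.
  have hzero : ℓ = 0 := by
    by_contra hne
    have h1 := hlt ℓ (hθ₀.trans_le hℓc) (lt_of_le_of_ne hℓ0 hne)
    rw [← inner_backEnd (K := L) hF hD₁ ℓ, ← inner_backEnd (K := L) hF hD₂ ℓ, hbe] at h1
    exact lt_irrefl _ h1
  subst hzero
  refine ⟨fun n => (x n).1, fun n => (P (x n)).1, rfl, fun n => (x n).2.2,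
    fun n => (P (x n)).2.2, hℓ, hφ, fun n => hP2 _, fun n => ?_⟩
  simp only [hxs]
  exact hQ2 _

end Sequence

/-! ### Gaps between the boundaries near a common tangent -/

section Gaps

variable {K L D D' D₁ D₂ : Set Plane} {e f : Plane} {i c : ℝ}

theorem frontEnd_eq_add (K L D : Set Plane) (e f : Plane) (θ : ℝ) :
    frontEnd K D e f θ = frontEnd L D e f θ +
      (chordRadial K D (frameTangent e f θ) (frameNormal e f θ) -
        chordRadial L D (frameTangent e f θ) (frameNormal e f θ)) • frameTangent e f θ := by
  simp only [frontEnd]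
  module

theorem backEnd_eq_add (K L D : Set Plane) (e f : Plane) (θ : ℝ) :
    backEnd K D e f θ = backEnd L D e f θ +
      (chordRadial L D (-frameTangent e f θ) (frameNormal e f θ) -
        chordRadial K D (-frameTangent e f θ) (frameNormal e f θ)) • frameTangent e f θ := by
  simp only [backEnd]
  module

/-- Here `w n` is to be the end shared by two chords of `L`, and `d`, `d'` the gaps to `∂K` along
their lines. Both directions tend to `f`, which is transversal to `∂K` at `p + a • f`, so the gaps
are asymptotically equal. -/
theorem tendsto_gap_ratio (hF : IsFrame e f) (hK : IsConvexBody K) {p : Plane}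
    (hp : p ∈ interior K) {a : ℝ} (ha : a ≠ 0) {w x y : ℕ → Plane} {d d' θ φ : ℕ → ℝ}
    (hd : ∀ n, d n ≠ 0) (hθ : Tendsto θ atTop (𝓝 0)) (hφ : Tendsto φ atTop (𝓝 0))
    (hx : ∀ n, x n ∈ frontier K) (hy : ∀ n, y n ∈ frontier K)
    (hxl : Tendsto x atTop (𝓝 (p + a • f))) (hyl : Tendsto y atTop (𝓝 (p + a • f)))
    (hxw : ∀ n, x n = w n + d n • frameTangent e f (θ n))
    (hyw : ∀ n, y n = w n + d' n • frameTangent e f (φ n)) :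
    Tendsto (fun n => |d' n| / |d n|) atTop (𝓝 1) := by
  obtain ⟨M, η, hM, hη, hlip⟩ := hK.exists_lipschitz hF hp ha
  have h := (tendsto_ratio_of_lipschitz hM hd hθ hφ (d' := d') ?_).abs
  · simpa only [abs_div, abs_one] using h
  · filter_upwards [hxl.eventually (Metric.ball_mem_nhds _ hη),
      hyl.eventually (Metric.ball_mem_nhds _ hη)] with n h1 h2
    have h3 := hlip _ (hx n) _ (hy n) h1 h2
    rw [hxw, hyw, add_sub_add_left_eq_sub, inner_sub_right, inner_sub_right,
      real_inner_smul_right, real_inner_smul_right, real_inner_smul_right, real_inner_smul_right,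
      hF.inner_right_tangent, hF.inner_right_tangent, hF.inner_left_tangent,
      hF.inner_left_tangent] at h3
    rw [abs_sub_comm (d n * Real.sin (θ n))]
    convert h3 using 3
    ring

/-- The depth of the shared point below the common tangent, computed along each of the two lines, is
distance times sine up to an error of smaller order, by `tendsto_height_contactPoint`. Equating the
two depths gives the ratio of the sines. -/
theorem tendsto_sin_ratio (hF : IsFrame e f) (hD : IsConvexBody D) (hD' : IsConvexBody D')
    (hc : HasC2SupportFun D) (hc' : HasC2SupportFun D')
    (h0 : supportFun D e = supportFun D' e) {t t' θ φ : ℕ → ℝ} {a a' : ℝ} (ha' : a' ≠ 0)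
    (hθ : Tendsto θ atTop (𝓝 0)) (hφ : Tendsto φ atTop (𝓝 0))
    (hθ0 : ∀ᶠ n in atTop, Real.sin (θ n) ≠ 0) (hφ0 : ∀ᶠ n in atTop, Real.sin (φ n) ≠ 0)
    (ht : Tendsto t atTop (𝓝 a)) (ht' : Tendsto t' atTop (𝓝 a'))
    (h : ∀ n, contactPoint D (frameNormal e f (φ n)) + t n • frameTangent e f (φ n) =
      contactPoint D' (frameNormal e f (θ n)) + t' n • frameTangent e f (θ n)) :
    Tendsto (fun n => Real.sin (θ n) / Real.sin (φ n)) atTop (𝓝 (a / a')) := by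
  have h1 := (tendsto_height_contactPoint hF hD hc hφ).sub ht
  have h2 := (tendsto_height_contactPoint hF hD' hc' hθ).sub ht'
  have hne : 0 - a' ≠ 0 := by simpa using ha'
  have h3 := h1.div h2 hne
  rw [zero_sub, zero_sub, neg_div_neg_eq] at h3
  refine h3.congr' ?_
  filter_upwards [hθ0, hφ0, h2.eventually_ne hne] with n hn1 hn2 hn3
  have h4 := congrArg (fun z => ⟪e, z⟫) (h n)
  simp only [inner_left_contactPoint_add hF] at h4
  simp only [Pi.div_apply]
  rw [div_eq_div_iff hn3 hn2, sub_mul, mul_sub, div_mul_cancel₀ _ hn2, mul_div_cancel₀ _ hn1, h0]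
  linarith

theorem eventually_abs_height_le (hF : IsFrame e f) (hD : IsConvexBody D)
    (hc : HasC2SupportFun D) {t θ : ℕ → ℝ} {a : ℝ} (hθ : Tendsto θ atTop (𝓝 0))
    (hθ0 : ∀ᶠ n in atTop, Real.sin (θ n) ≠ 0) (ht : Tendsto t atTop (𝓝 a)) :
    ∀ᶠ n in atTop, |⟪e, contactPoint D (frameNormal e f (θ n)) +
      t n • frameTangent e f (θ n)⟫ - supportFun D e| ≤ (|a| + 1) * |Real.sin (θ n)| := by
  have h1 := ((tendsto_height_contactPoint hF hD hc hθ).sub ht).abs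
  rw [zero_sub, abs_neg] at h1
  filter_upwards [hθ0, h1.eventually_lt_const (lt_add_one _)] with n hn1 hn2
  have h2 := mul_le_mul_of_nonneg_right hn2.le (abs_nonneg (Real.sin (θ n)))
  rw [← abs_mul, sub_mul, div_mul_cancel₀ _ hn1] at h2
  rw [inner_left_contactPoint_add hF, sub_right_comm]
  exact h2

/-- At a common endpoint of tangent chords the gap is at most proportional to the angle. -/
theorem exists_gap_le (hF : IsFrame e f) (hK : IsConvexBody K) (hL : IsConvexBody L)
    (hD : IsConvexBody D) (hc : HasC2SupportFun D) (hDK : D ⊆ interior K)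
    (hDL : D ⊆ interior L) (h0 : frontEnd K D e f 0 = frontEnd L D e f 0) {θ : ℕ → ℝ}
    (hθ : Tendsto θ atTop (𝓝 0)) (hθ0 : ∀ᶠ n in atTop, Real.sin (θ n) ≠ 0) :
    ∃ C, ∀ᶠ n in atTop, |chordRadial K D (frameTangent e f (θ n)) (frameNormal e f (θ n)) -
      chordRadial L D (frameTangent e f (θ n)) (frameNormal e f (θ n))| ≤
        C * |Real.sin (θ n)| := by
  -- For each body, the end moves along `f` by at most a Lipschitz constant times its height change,
  -- which is of the order of the sine. Since `K` and `L` have the same end at angle `0`, the two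
  -- displacements can be subtracted.
  have single : ∀ {J : Set Plane}, IsConvexBody J → D ⊆ interior J →
      ∃ C, ∀ᶠ n in atTop, |⟪f, frontEnd J D e f (θ n) - frontEnd J D e f 0⟫| ≤
        C * |Real.sin (θ n)| := by
    intro J hJ hDJ
    obtain ⟨M, η, hM, hη, hlip⟩ := hJ.exists_lipschitz hF
      (hDJ (hD.contactPoint_mem_self (frameNormal e f 0))) (chordRadial_pos hF hJ hD hDJ 0).ne'
    have hA : frontEnd J D e f 0 = contactPoint D (frameNormal e f 0) +
      chordRadial J D (frameTangent e f 0) (frameNormal e f 0) • f := by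
      rw [frontEnd, frameTangent_zero]
    rw [← hA] at hlip
    have hz := ((continuous_frontEnd hF hJ hD hc hDJ).tendsto 0).comp hθ
    have ht := ((continuous_chordRadial hF hJ hD hc hDJ).tendsto 0).comp hθ
    refine ⟨M * (|chordRadial J D (frameTangent e f 0) (frameNormal e f 0)| + 1), ?_⟩
    filter_upwards [hz.eventually (Metric.ball_mem_nhds _ hη),
      eventually_abs_height_le hF hD hc hθ hθ0 ht] with n h1 h2
    have h3 := hlip _ (frontEnd_mem hF hJ hD hDJ (θ n)) _ (frontEnd_mem hF hJ hD hDJ 0) h1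
      (by simpa using hη)
    have h4 : ⟪e, frontEnd J D e f 0⟫ = supportFun D e := by
      have := inner_frontEnd (K := J) hF hD 0
      rwa [frameNormal_zero] at this
    rw [inner_sub_right e, h4] at h3
    rw [mul_assoc]
    exact h3.trans (mul_le_mul_of_nonneg_left h2 hM.le)
  obtain ⟨C₁, h1⟩ := single hK hDK
  obtain ⟨C₂, h2⟩ := single hL hDL
  have hcos : ∀ᶠ n in atTop, 1 / 2 < Real.cos (θ n) :=
    ((Real.continuous_cos.tendsto 0).comp hθ).eventually_const_lt (by norm_num)
  refine ⟨2 * (C₁ + C₂), ?_⟩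
  filter_upwards [h1, h2, hcos] with n h1 h2 h3
  rw [h0] at h1
  have h4 := frontEnd_eq_add K L D e f (θ n)
  set δ := chordRadial K D (frameTangent e f (θ n)) (frameNormal e f (θ n)) -
      chordRadial L D (frameTangent e f (θ n)) (frameNormal e f (θ n)) with hδ
  have h5 : δ * Real.cos (θ n) = ⟪f, frontEnd K D e f (θ n) - frontEnd L D e f 0⟫ -
      ⟪f, frontEnd L D e f (θ n) - frontEnd L D e f 0⟫ := by
    rw [← inner_sub_right, sub_sub_sub_cancel_right, h4, add_sub_cancel_left,
      real_inner_smul_right, hF.inner_right_tangent]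
  have h6 := abs_sub ⟪f, frontEnd K D e f (θ n) - frontEnd L D e f 0⟫
    ⟪f, frontEnd L D e f (θ n) - frontEnd L D e f 0⟫
  rw [← h5, abs_mul, abs_of_pos (show 0 < Real.cos (θ n) by linarith)] at h6
  nlinarith [abs_nonneg δ]

end Gaps

/-! ### Common chords on one side of a common tangent -/

section Core

variable {K L D₁ D₂ : Set Plane} {e f : Plane} {i c : ℝ}

theorem frontEnd_mem_of_alternating (h₁ : IsChordEquivalent K L D₁ i)
    (h₂ : IsChordEquivalent K L D₂ i) (hi : 0 < i) (hF : IsFrame e f) {θ φ : ℕ → ℝ}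
    (hb : ∀ n, backEnd L D₁ e f (θ n) = backEnd L D₂ e f (φ n))
    (hf : ∀ n, frontEnd L D₂ e f (φ n) = frontEnd L D₁ e f (θ (n + 1))) (n : ℕ) :
    frontEnd L D₁ e f (θ n) ∈ frontier K ↔ frontEnd L D₁ e f (θ 0) ∈ frontier K := by
  induction n with
  | zero => rfl
  | succ n ih =>
    rw [← ih, ← hf n, h₂.frontEnd_mem_iff_backEnd_mem hi hF, ← hb n,
      ← h₁.frontEnd_mem_iff_backEnd_mem hi hF]

/-- If the gaps never vanish along the chain, gap over sine grows geometrically, although a common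
limit chord keeps it bounded. The growth comes from the order of the two contact points on the
common tangent. -/
theorem not_alternating_of_gap (h₁ : IsChordEquivalent K L D₁ i)
    (h₂ : IsChordEquivalent K L D₂ i) (hi : 0 < i) (hF : IsFrame e f)
    (h0 : supportFun D₁ e = supportFun D₂ e)
    (hp : ⟪f, contactPoint D₁ e⟫ < ⟪f, contactPoint D₂ e⟫)
    (hg₁ : frontEnd L D₁ e f 0 ∈ frontier K) (hg₂ : frontEnd L D₂ e f 0 ∈ frontier K)
    {θ φ : ℕ → ℝ} (hθneg : ∀ n, θ n < 0) (hφneg : ∀ n, φ n < 0)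
    (hθ : Tendsto θ atTop (𝓝 0)) (hφ : Tendsto φ atTop (𝓝 0))
    (hb : ∀ n, backEnd L D₁ e f (θ n) = backEnd L D₂ e f (φ n))
    (hf : ∀ n, frontEnd L D₂ e f (φ n) = frontEnd L D₁ e f (θ (n + 1)))
    (hne : ∀ n, frontEnd L D₁ e f (θ n) ∉ frontier K) : False := by
  have hne₁' : ∀ n, backEnd L D₁ e f (θ n) ∉ frontier K := fun n => by
    rw [← h₁.frontEnd_mem_iff_backEnd_mem hi hF]; exact hne n
  have hne₂' : ∀ n, backEnd L D₂ e f (φ n) ∉ frontier K := fun n => by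
    rw [← hb]; exact hne₁' n
  have hne₂ : ∀ n, frontEnd L D₂ e f (φ n) ∉ frontier K := fun n => by
    rw [hf]; exact hne _
  have hθ' : Tendsto (fun n => θ (n + 1)) atTop (𝓝 0) := hθ.comp (tendsto_add_atTop_nat 1)
  have hsin : ∀ {ψ : ℕ → ℝ}, (∀ n, ψ n < 0) → Tendsto ψ atTop (𝓝 0) →
      ∀ᶠ n in atTop, Real.sin (ψ n) ≠ 0 := by
    intro ψ h1 h2
    filter_upwards [h2.eventually_const_lt (neg_lt_zero.2 Real.pi_pos)] with n hn
    exact (Real.sin_neg_of_neg_of_neg_pi_lt (h1 n) hn).ne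
  have hsθ := hsin hθneg hθ
  have hsφ := hsin hφneg hφ
  have hsθ' := hsin (fun n => hθneg (n + 1)) hθ'
  -- the four radii on the common tangent
  set a₁ := chordRadial L D₁ (frameTangent e f 0) (frameNormal e f 0) with ha₁
  set b₁ := chordRadial L D₁ (-frameTangent e f 0) (frameNormal e f 0) with hb₁
  set a₂ := chordRadial L D₂ (frameTangent e f 0) (frameNormal e f 0) with ha₂
  set b₂ := chordRadial L D₂ (-frameTangent e f 0) (frameNormal e f 0) with hb₂
  have ka₁ := (h₁.frontEnd_mem_iff hF 0).1 hg₁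
  have kb₁ := (h₁.backEnd_mem_iff hF 0).1 ((h₁.frontEnd_mem_iff_backEnd_mem hi hF 0).1 hg₁)
  have ka₂ := (h₂.frontEnd_mem_iff hF 0).1 hg₂
  have kb₂ := (h₂.backEnd_mem_iff hF 0).1 ((h₂.frontEnd_mem_iff_backEnd_mem hi hF 0).1 hg₂)
  have pa₁ : 0 < a₁ := chordRadial_pos hF h₁.right h₁.body h₁.subset_right 0
  have pb₁ : 0 < b₁ := chordRadial_neg_pos hF h₁.right h₁.body h₁.subset_right 0
  have pa₂ : 0 < a₂ := chordRadial_pos hF h₂.right h₂.body h₂.subset_right 0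
  have pb₂ : 0 < b₂ := chordRadial_neg_pos hF h₂.right h₂.body h₂.subset_right 0
  -- On the common tangent both bodies cut the same chord of `L`, and `D₂` touches it further ahead
  -- by `s`; hence `a₁ = a₂ + s` and `b₂ = b₁ + s`.
  obtain ⟨s, hs⟩ : ∃ s : ℝ, contactPoint D₂ (frameNormal e f 0) =
      contactPoint D₁ (frameNormal e f 0) + s • frameTangent e f 0 := by
    refine hF.eq_contactPoint_add h₁.body ?_
    rw [h₂.body.inner_contactPoint, frameNormal_zero, h0]
  have hs0 : 0 < s := by
    rw [frameNormal_zero, frameTangent_zero] at hs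
    rw [hs, inner_add_right, real_inner_smul_right, hF.inner_self_right] at hp
    linarith
  have hfr : frontEnd L D₁ e f 0 = frontEnd L D₂ e f 0 := by
    have h1 := frontEnd_mem hF h₂.right h₂.body h₂.subset_right 0
    rw [frontEnd, hs, add_assoc, ← add_smul,
      add_smul_mem_frontier_iff_pos hF h₁.right h₁.body h₁.subset_right 0 (by positivity)] at h1
    rw [frontEnd, frontEnd, hs, add_assoc, ← add_smul, h1]
  have hbk : backEnd L D₁ e f 0 = backEnd L D₂ e f 0 := by
    have h1 := backEnd_mem hF h₁.right h₁.body h₁.subset_right 0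
    have h2 : backEnd L D₁ e f 0 = contactPoint D₂ (frameNormal e f 0) +
        (-b₁ - s) • frameTangent e f 0 := by
      rw [backEnd, hs]
      module
    rw [h2, add_smul_mem_frontier_iff_neg hF h₂.right h₂.body h₂.subset_right 0
      (by linarith)] at h1
    rw [h2, h1, backEnd]
  have hτ : frameTangent e f 0 ≠ 0 := hF.tangent_ne_zero 0
  have haa : a₂ < a₁ := by
    have h1 := hfr
    rw [frontEnd, frontEnd, hs, add_assoc, ← add_smul, add_right_inj] at h1
    have := smul_left_injective ℝ hτ h1
    linarith
  have hbb : b₁ < b₂ := by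
    have h1 := hbk
    rw [backEnd, backEnd, hs, add_assoc, ← add_smul, add_right_inj] at h1
    have := smul_left_injective ℝ hτ h1
    linarith
  have hKL₁ : frontEnd K D₁ e f 0 = frontEnd L D₁ e f 0 := by
    rw [frontEnd, frontEnd, ka₁]
  have hKL₂ : frontEnd K D₂ e f 0 = frontEnd L D₂ e f 0 := by
    rw [frontEnd, frontEnd, ka₂]
  have hKLb₁ : backEnd K D₁ e f 0 = backEnd L D₁ e f 0 := by
    rw [backEnd, backEnd, kb₁]
  have hKLb₂ : backEnd K D₂ e f 0 = backEnd L D₂ e f 0 := by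
    rw [backEnd, backEnd, kb₂]
  -- radii along the sequence
  have tL₁ := ((continuous_chordRadial hF h₁.right h₁.body h₁.c2 h₁.subset_right).tendsto 0)
  have tK₁ := ((continuous_chordRadial hF h₁.left h₁.body h₁.c2 h₁.subset_left).tendsto 0)
  have tL₂ := ((continuous_chordRadial hF h₂.right h₂.body h₂.c2 h₂.subset_right).tendsto 0)
  have tK₂ := ((continuous_chordRadial hF h₂.left h₂.body h₂.c2 h₂.subset_left).tendsto 0)
  have tL₁' := ((continuous_chordRadial_neg hF h₁.right h₁.body h₁.c2 h₁.subset_right).tendsto 0)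
  have tK₁' := ((continuous_chordRadial_neg hF h₁.left h₁.body h₁.c2 h₁.subset_left).tendsto 0)
  have tL₂' := ((continuous_chordRadial_neg hF h₂.right h₂.body h₂.c2 h₂.subset_right).tendsto 0)
  have tK₂' := ((continuous_chordRadial_neg hF h₂.left h₂.body h₂.c2 h₂.subset_left).tendsto 0)
  rw [ka₁] at tK₁
  rw [kb₁] at tK₁'
  rw [ka₂] at tK₂
  rw [kb₂] at tK₂'
  have n₁ : ∀ n, chordRadial K D₁ (frameTangent e f (θ n)) (frameNormal e f (θ n)) ≠
      chordRadial L D₁ (frameTangent e f (θ n)) (frameNormal e f (θ n)) := fun n h =>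
    hne n ((h₁.frontEnd_mem_iff hF _).2 h)
  have n₁' : ∀ n, chordRadial K D₁ (-frameTangent e f (θ n)) (frameNormal e f (θ n)) ≠
      chordRadial L D₁ (-frameTangent e f (θ n)) (frameNormal e f (θ n)) := fun n h =>
    hne₁' n ((h₁.backEnd_mem_iff hF _).2 h)
  have n₂ : ∀ n, chordRadial K D₂ (frameTangent e f (φ n)) (frameNormal e f (φ n)) ≠
      chordRadial L D₂ (frameTangent e f (φ n)) (frameNormal e f (φ n)) := fun n h =>
    hne₂ n ((h₂.frontEnd_mem_iff hF _).2 h)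
  have n₂' : ∀ n, chordRadial K D₂ (-frameTangent e f (φ n)) (frameNormal e f (φ n)) ≠
      chordRadial L D₂ (-frameTangent e f (φ n)) (frameNormal e f (φ n)) := fun n h =>
    hne₂' n ((h₂.backEnd_mem_iff hF _).2 h)
  have r1 := tendsto_ratio_of_rpow pa₁ pb₁ hi (tK₁.comp hθ) (tL₁.comp hθ) (tK₁'.comp hθ)
    (tL₁'.comp hθ) n₁ n₁' fun n => h₁.abs_sub_eq_frame hF (θ n)
  have r3 := tendsto_ratio_of_rpow pb₂ pa₂ hi (tK₂'.comp hφ) (tL₂'.comp hφ) (tK₂.comp hφ)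
    (tL₂.comp hφ) n₂' n₂ fun n => (h₂.abs_sub_eq_frame hF (φ n)).symm
  have fK₁ := ((continuous_frontEnd hF h₁.left h₁.body h₁.c2 h₁.subset_left).tendsto 0).comp hθ'
  have fK₂ := ((continuous_frontEnd hF h₂.left h₂.body h₂.c2 h₂.subset_left).tendsto 0).comp hφ
  have bK₁ := ((continuous_backEnd hF h₁.left h₁.body h₁.c2 h₁.subset_left).tendsto 0).comp hθ
  have bK₂ := ((continuous_backEnd hF h₂.left h₂.body h₂.c2 h₂.subset_left).tendsto 0).comp hφ
  have eA : frontEnd L D₁ e f 0 = contactPoint D₁ (frameNormal e f 0) + a₁ • f := by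
    rw [frontEnd, frameTangent_zero, ha₁, frameTangent_zero]
  have eB : backEnd L D₁ e f 0 = contactPoint D₁ (frameNormal e f 0) + (-b₁) • f := by
    rw [backEnd, frameTangent_zero, hb₁, frameTangent_zero]
  rw [hKL₁, eA] at fK₁
  rw [hKL₂, ← hfr, eA] at fK₂
  rw [hKLb₁, eB] at bK₁
  rw [hKLb₂, ← hbk, eB] at bK₂
  have hpK := h₁.subset_left (h₁.body.contactPoint_mem_self (frameNormal e f 0))
  have r2 := tendsto_gap_ratio hF h₁.left hpK (neg_ne_zero.2 pb₁.ne')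
    (fun n => sub_ne_zero.2 (n₁' n).symm) hθ hφ
    (fun n => backEnd_mem hF h₁.left h₁.body h₁.subset_left (θ n))
    (fun n => backEnd_mem hF h₂.left h₂.body h₂.subset_left (φ n)) bK₁ bK₂
    (fun n => backEnd_eq_add K L D₁ e f (θ n))
    (fun n => (backEnd_eq_add K L D₂ e f (φ n)).trans (by rw [hb]))
  have r4 := tendsto_gap_ratio hF h₁.left hpK pa₁.ne'
    (fun n => sub_ne_zero.2 (n₂ n)) hφ hθ'
    (fun n => frontEnd_mem hF h₂.left h₂.body h₂.subset_left (φ n))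
    (fun n => frontEnd_mem hF h₁.left h₁.body h₁.subset_left (θ (n + 1))) fK₂ fK₁
    (fun n => frontEnd_eq_add K L D₂ e f (φ n))
    (fun n => (frontEnd_eq_add K L D₁ e f (θ (n + 1))).trans (by rw [hf]))
  have s1 := (tendsto_sin_ratio hF h₂.body h₁.body h₂.c2 h₁.c2 h0.symm
    (neg_ne_zero.2 pb₁.ne') hθ hφ hsθ hsφ (tL₂'.comp hφ).neg (tL₁'.comp hθ).neg
    fun n => (hb n).symm).abs
  have s2 := (tendsto_sin_ratio hF h₁.body h₂.body h₁.c2 h₂.c2 h0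
    pa₂.ne' hφ hθ' hsφ hsθ' (tL₁.comp hθ') (tL₂.comp hφ) fun n => (hf n).symm).abs
  rw [neg_div_neg_eq, abs_of_pos (by positivity)] at s1
  rw [abs_of_pos (by positivity)] at s2
  obtain ⟨C, hC⟩ := exists_gap_le hF h₁.left h₁.right h₁.body h₁.c2 h₁.subset_left
    h₁.subset_right hKL₁ hθ hsθ
  set X := a₁ / b₁ * (b₂ / a₂) with hX
  have hX1 : 1 < X := by
    rw [hX, div_mul_div_comm, one_lt_div (by positivity)]
    nlinarith
  refine not_bounded_of_ratio_tendsto (κ := X ^ i) (C := C)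
    (q := fun n => |chordRadial K D₁ (frameTangent e f (θ n)) (frameNormal e f (θ n)) -
      chordRadial L D₁ (frameTangent e f (θ n)) (frameNormal e f (θ n))| / |Real.sin (θ n)|)
    (Real.one_lt_rpow hX1 hi) ?_ ?_ ?_
  · filter_upwards [hsθ] with n hn
    exact div_pos (abs_pos.2 (sub_ne_zero.2 (n₁ n))) (abs_pos.2 hn)
  · filter_upwards [hC, hsθ] with n h1 h2
    rwa [div_le_iff₀ (abs_pos.2 h2)]
  -- One double step: front to back on `D₁`, change at the back end, back to front on `D₂`, change
  -- at the front end, then the two sine ratios. The gap factors contribute `X ^ (i - 1)` and the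
  -- sines one more `X`.
  · have hlim := ((((r1.mul r2).mul r3).mul r4).mul s1).mul s2
    have hval : (a₁ / b₁) ^ (i - 1) * 1 * (b₂ / a₂) ^ (i - 1) * 1 * (b₂ / b₁) * (a₁ / a₂) =
        X ^ i := by
      have h1 : b₂ / b₁ * (a₁ / a₂) = X := by
        rw [hX]
        field_simp
      rw [mul_one, mul_one, ← Real.mul_rpow (by positivity) (by positivity), ← hX, mul_assoc, h1,
        Real.rpow_sub_one (by positivity), div_mul_cancel₀ _ (by positivity)]
    rw [hval] at hlim
    refine hlim.congr' ?_
    filter_upwards [hsθ, hsφ, hsθ'] with n m1 m2 m3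
    simp only [Function.comp_apply, abs_div]
    rw [abs_sub_comm (chordRadial L D₁ (-frameTangent e f (θ n)) _),
      abs_sub_comm (chordRadial L D₂ (-frameTangent e f (φ n)) _)]
    have k1 := abs_pos.2 (sub_ne_zero.2 (n₁ n))
    have k2 := abs_pos.2 (sub_ne_zero.2 (n₁' n))
    have k3 := abs_pos.2 (sub_ne_zero.2 (n₂ n))
    have k4 := abs_pos.2 (sub_ne_zero.2 (n₂' n))
    have k5 := abs_pos.2 m1
    have k6 := abs_pos.2 m2
    have k7 := abs_pos.2 m3
    field_simp

/-- On the side of a common tangent where `D₁` reaches further out, all tangent chords are common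
to both bodies as soon as the chord on the common tangent is, and conversely. -/
theorem hasCommonChord_iff_of_lt (h₁ : IsChordEquivalent K L D₁ i)
    (h₂ : IsChordEquivalent K L D₂ i) (hi : 0 < i) (hF : IsFrame e f)
    (h0 : supportFun D₁ e = supportFun D₂ e)
    (hp : ⟪f, contactPoint D₁ e⟫ < ⟪f, contactPoint D₂ e⟫)
    (hlt : ∀ θ, -c < θ → θ < 0 →
      supportFun D₂ (frameNormal e f θ) < supportFun D₁ (frameNormal e f θ))
    {θ₀ : ℝ} (hθ₀ : -c < θ₀) (hθ₀' : θ₀ < 0) :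
    (HasCommonChord K L D₁ (frameNormal e f θ₀) ↔ HasCommonChord K L D₁ e) ∧
      (HasCommonChord K L D₂ (frameNormal e f θ₀) ↔ HasCommonChord K L D₁ e) := by
  have main : ∀ θ₀, -c < θ₀ → θ₀ < 0 →
      (HasCommonChord K L D₁ (frameNormal e f θ₀) ↔ HasCommonChord K L D₁ e) := by
    intro θ₀ hθ₀ hθ₀'
    obtain ⟨θ, φ, rfl, hθneg, hφneg, hθ, hφ, hb, hf⟩ := exists_alternating_chords hF h₁.right
      h₁.body h₂.body h₁.c2 h₂.c2 h₁.subset_right h₂.subset_right h0 hlt hθ₀ hθ₀'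
    have hall := frontEnd_mem_of_alternating h₁ h₂ hi hF hb hf
    have he : HasCommonChord K L D₁ e ↔ frontEnd L D₁ e f 0 ∈ frontier K := by
      rw [← h₁.hasCommonChord_iff hi hF 0, frameNormal_zero]
    rw [h₁.hasCommonChord_iff hi hF]
    constructor
    · intro hg
      rw [he]
      refine isClosed_frontier.mem_of_tendsto
        (((continuous_frontEnd hF h₁.right h₁.body h₁.c2 h₁.subset_right).tendsto 0).comp hθ)
        (Eventually.of_forall fun n => (hall n).2 hg)
    · intro hg
      by_contra hne
      refine not_alternating_of_gap h₁ h₂ hi hF h0 hp (he.1 hg) ?_ hθneg hφneg hθ hφ hb hf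
        fun n hn => hne ((hall n).1 hn)
      refine hg _ (frontEnd_mem hF h₂.right h₂.body h₂.subset_right 0) ?_
      have := inner_frontEnd (K := L) hF h₂.body 0
      rwa [frameNormal_zero, ← h0] at this
  refine ⟨main θ₀ hθ₀ hθ₀', ?_⟩
  -- The chord of `D₂` at `θ₀` shares its front end with a chord of `D₁` nearer to the common
  -- tangent, to which `main` applies.
  obtain ⟨θ, h3, h4, h5⟩ := exists_frontEnd_eq hF h₁.right h₁.body h₂.body h₁.c2 h₁.subset_right
    h₂.subset_right h0 hθ₀' (hlt θ₀ hθ₀ hθ₀')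
  rw [← main θ (hθ₀.trans h3) h4, h₂.hasCommonChord_iff hi hF, h₁.hasCommonChord_iff hi hF, h5]

end Core

/-! ### Common supporting lines of admissible bodies -/

section Lines

variable {D₁ D₂ : Set Plane}

theorem normalLine_eq_iff {ξ ξ' : Plane} {c c' : ℝ} (hξ : ‖ξ‖ = 1) (hξ' : ‖ξ'‖ = 1)
    (h : normalLine ξ c = normalLine ξ' c') : (ξ' = ξ ∧ c' = c) ∨ (ξ' = -ξ ∧ c' = -c) := by
  obtain ⟨f, hF⟩ := exists_isFrame hξ
  have h1 : c • ξ ∈ normalLine ξ' c' := by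
    rw [← h, normalLine, mem_ofPred_eq, real_inner_smul_right, hF.inner_self_left, mul_one]
  have h2 : c • ξ + f ∈ normalLine ξ' c' := by
    rw [← h, normalLine, mem_ofPred_eq, inner_add_right, real_inner_smul_right,
      hF.inner_self_left, mul_one, hF.inner_eq_zero, add_zero]
  simp only [normalLine, mem_ofPred_eq, inner_add_right, real_inner_smul_right] at h1 h2
  have h3 : ⟪f, ξ'⟫ = 0 := by
    rw [real_inner_comm]
    linarith
  have h4 : ξ' = ⟪ξ, ξ'⟫ • ξ := by
    conv_lhs => rw [hF.eq_add ξ', h3, zero_smul, add_zero]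
  have h5 : ⟪ξ, ξ'⟫ * ⟪ξ, ξ'⟫ = 1 := by
    have := hF.inner_eq ξ' ξ'
    rw [real_inner_self_eq_norm_sq, hξ', h3, mul_zero, add_zero, one_pow] at this
    exact this.symm
  rw [real_inner_comm] at h1
  rcases mul_self_eq_one_iff.1 h5 with h6 | h6
  · left
    rw [h6] at h1 h4
    exact ⟨by simpa using h4, by linarith⟩
  · right
    rw [h6] at h1 h4
    exact ⟨by simpa using h4, by linarith⟩

/-- The non-separating common supporting lines correspond to the unit vectors at which the
support functions agree. -/
theorem Admissible.encard_eq_two (hD : Admissible D₁ D₂) :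
    {v : Plane | ‖v‖ = 1 ∧ supportFun D₁ v = supportFun D₂ v}.encard = 2 := by
  have hb₁ := hD.isConvexBody_left
  have hb₂ := hD.isConvexBody_right
  have hne : ∀ {v : Plane}, ‖v‖ = 1 → v ≠ 0 := fun h h0 => by simp [h0] at h
  have sup_eq : ∀ {D : Set Plane} {ξ : Plane} {c : ℝ}, IsConvexBody D →
      (D ∩ normalLine ξ c).Nonempty → (∀ x ∈ D, ⟪ξ, x⟫ ≤ c) → supportFun D ξ = c := by
    rintro D ξ c hb ⟨x, hx, hxc⟩ hle
    refine le_antisymm ?_ ?_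
    · rw [← hb.inner_contactPoint]
      exact hle _ (hb.contactPoint_mem_self ξ)
    · rw [← show ⟪ξ, x⟫ = c from hxc]
      exact hb.inner_le_supportFun ξ hx
  rw [← hD.two_lines]
  have himg : {H : Set Plane | IsSupportingLine H D₁ ∧ IsSupportingLine H D₂ ∧
      ¬ LineSeparates H D₁ D₂} = (fun v => normalLine v (supportFun D₁ v)) ''
      {v : Plane | ‖v‖ = 1 ∧ supportFun D₁ v = supportFun D₂ v} := by
    ext H
    constructor
    · rintro ⟨⟨ξ, c, hξ, rfl, hm, hle⟩, ⟨ξ', c', hξ', hH, hm', hle'⟩, hsep⟩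
      rcases normalLine_eq_iff hξ hξ' hH with ⟨rfl, rfl⟩ | ⟨rfl, rfl⟩
      · have e1 := sup_eq hb₁ hm hle
        refine ⟨ξ', ⟨hξ, ?_⟩, ?_⟩
        · rw [e1, sup_eq hb₂ hm' hle']
        · simp only [e1]
      · refine absurd ⟨ξ, c, hξ, rfl, hle, fun x hx => ?_⟩ hsep
        have := hle' x hx
        rw [inner_neg_left] at this
        linarith
    · rintro ⟨v, ⟨hv, hv'⟩, rfl⟩
      refine ⟨⟨v, _, hv, rfl, ⟨_, contactPoint_mem hb₁ v⟩, fun x => hb₁.inner_le_supportFun v⟩,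
        ⟨v, _, hv, rfl, ?_, ?_⟩, ?_⟩
      · beta_reduce
        rw [hv']
        exact ⟨_, contactPoint_mem hb₂ v⟩
      · rw [hv']
        exact fun x => hb₂.inner_le_supportFun v
      · rintro ⟨ξ, c, hξ, hH, hs1, hs2⟩
        rcases normalLine_eq_iff hv hξ hH with ⟨rfl, rfl⟩ | ⟨rfl, rfl⟩
        · obtain ⟨p, hp⟩ := hb₂.interior_nonempty
          have h1 := hb₂.inner_lt_supportFun (hne hξ) hp
          have h2 := hs2 p (interior_subset hp)
          linarith
        · obtain ⟨p, hp⟩ := hb₁.interior_nonempty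
          have h1 := hb₁.inner_lt_supportFun (hne hv) hp
          have h2 := hs1 p (interior_subset hp)
          rw [inner_neg_left] at h2
          linarith
  rw [himg, InjOn.encard_image]
  rintro v ⟨hv, -⟩ w ⟨hw, -⟩ hvw
  rcases normalLine_eq_iff hv hw hvw with ⟨h, -⟩ | ⟨rfl, h⟩
  · exact h.symm
  · have := hb₁.width_pos (hne hv)
    linarith

theorem IsConvexBody.exists_supportFun_lt {D : Set Plane} (hD : IsConvexBody D) {m : Plane}
    (hm : m ∉ D) : ∃ w : Plane, supportFun D w < ⟪w, m⟫ := by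
  obtain ⟨g, u, hg, hgm⟩ := geometric_hahn_banach_closed_point hD.convex hD.isCompact.isClosed hm
  obtain ⟨w, rfl⟩ := (InnerProductSpace.toDual ℝ Plane).surjective g
  simp only [InnerProductSpace.toDual_apply_apply] at hg hgm
  refine ⟨w, lt_trans ?_ hgm⟩
  rw [← hD.inner_contactPoint]
  exact hg _ (hD.contactPoint_mem_self w)

/-- If two bodies touch each common supporting line at a common point, their union is convex. -/
theorem convex_union_of_contactPoint_eq (hb₁ : IsConvexBody D₁) (hb₂ : IsConvexBody D₂)
    (hc₁ : HasC2SupportFun D₁) (hc₂ : HasC2SupportFun D₂)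
    (hex : ∃ v : Plane, ‖v‖ = 1 ∧ supportFun D₁ v = supportFun D₂ v)
    (h : ∀ v : Plane, ‖v‖ = 1 → supportFun D₁ v = supportFun D₂ v →
      contactPoint D₁ v = contactPoint D₂ v) : Convex ℝ (D₁ ∪ D₂) := by
  have key : ∀ x ∈ D₁, ∀ y ∈ D₂, ∀ a b : ℝ, 0 ≤ a → 0 ≤ b → a + b = 1 →
      a • x + b • y ∈ D₁ ∪ D₂ := by
    intro x hx y hy a b ha hb hab
    by_contra hm
    rw [mem_union, not_or] at hm
    obtain ⟨w₁, hw₁⟩ := hb₁.exists_supportFun_lt hm.1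
    obtain ⟨w₂, hw₂⟩ := hb₂.exists_supportFun_lt hm.2
    set m := a • x + b • y with hmdef
    have hull : ∀ w : Plane, ⟪w, m⟫ ≤ a * supportFun D₁ w + b * supportFun D₂ w := by
      intro w
      rw [hmdef, inner_add_right, real_inner_smul_right, real_inner_smul_right]
      exact add_le_add (mul_le_mul_of_nonneg_left (hb₁.inner_le_supportFun w hx) ha)
        (mul_le_mul_of_nonneg_left (hb₂.inner_le_supportFun w hy) hb)
    have hlt₁ : supportFun D₁ w₁ < supportFun D₂ w₁ := by
      have h1 := hw₁.trans_le (hull w₁)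
      have h2 : a = 1 - b := by linarith
      subst h2
      by_contra hcon
      nlinarith
    have hlt₂ : supportFun D₂ w₂ < supportFun D₁ w₂ := by
      have h1 := hw₂.trans_le (hull w₂)
      have h2 : b = 1 - a := by linarith
      subst h2
      by_contra hcon
      nlinarith
    -- A point of both bodies is strictly separated from `m` by every functional between `w₁` and
    -- `w₂`. This shows that none of them is zero, and it contradicts `hull` at the one where the
    -- support functions agree, for there the common contact point is at least as far out as `m`.
    have sep : ∀ q ∈ D₁, q ∈ D₂ → ∀ s ∈ Icc (0 : ℝ) 1,
        ⟪(1 - s) • w₁ + s • w₂, q⟫ < ⟪(1 - s) • w₁ + s • w₂, m⟫ := by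
      intro q hq1 hq2 s hs
      have h1 := (hb₁.inner_le_supportFun w₁ hq1).trans_lt hw₁
      have h2 := (hb₂.inner_le_supportFun w₂ hq2).trans_lt hw₂
      simp only [inner_add_left, real_inner_smul_left]
      rcases hs.1.eq_or_lt with h0 | h0
      · rw [← h0]
        linarith
      · have h3 := mul_lt_mul_of_pos_left h2 h0
        have h4 := mul_le_mul_of_nonneg_left h1.le (sub_nonneg.2 hs.2)
        linarith
    obtain ⟨e, he, he'⟩ := hex
    have hP := h e he he'
    have hne : ∀ s ∈ Icc (0 : ℝ) 1, (1 - s) • w₁ + s • w₂ ≠ 0 := by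
      intro s hs h0
      have := sep (contactPoint D₁ e) (hb₁.contactPoint_mem_self e)
        (hP ▸ hb₂.contactPoint_mem_self e) s hs
      rw [h0, inner_zero_left, inner_zero_left] at this
      exact lt_irrefl _ this
    have hpath : ContinuousOn (fun s : ℝ => (1 - s) • w₁ + s • w₂) (Icc 0 1) := by fun_prop
    have hcont : ContinuousOn (fun s : ℝ => supportFun D₁ ((1 - s) • w₁ + s • w₂) -
        supportFun D₂ ((1 - s) • w₁ + s • w₂)) (Icc 0 1) :=
      (hc₁.continuousOn.comp hpath hne).sub (hc₂.continuousOn.comp hpath hne)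
    obtain ⟨s, hs, hs0⟩ := intermediate_value_Icc zero_le_one hcont
      (show (0 : ℝ) ∈ _ by
        constructor
        · simpa using hlt₁.le
        · simpa using hlt₂.le)
    set w := (1 - s) • w₁ + s • w₂ with hw
    have hw0 : w ≠ 0 := hne s hs
    have hws : supportFun D₁ w = supportFun D₂ w := sub_eq_zero.1 hs0
    have hn : 0 < ‖w‖⁻¹ := inv_pos.2 (norm_pos_iff.2 hw0)
    have hQ := h (‖w‖⁻¹ • w) (norm_smul_inv_norm hw0) (by
      rw [hb₁.supportFun_smul hn.le, hb₂.supportFun_smul hn.le, hws])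
    have hQw := hb₁.inner_contactPoint (‖w‖⁻¹ • w)
    rw [hb₁.supportFun_smul hn.le, real_inner_smul_left] at hQw
    have h1 := sep (contactPoint D₁ (‖w‖⁻¹ • w)) (hb₁.contactPoint_mem_self _)
      (hQ ▸ hb₂.contactPoint_mem_self _) s hs
    rw [← hw, mul_left_cancel₀ hn.ne' hQw] at h1
    have h2 := hull w
    rw [← hws, ← add_mul, hab, one_mul] at h2
    linarith
  rintro x (hx | hx) y (hy | hy) a b ha hb hab
  · exact Or.inl (hb₁.convex hx hy ha hb hab)
  · exact key x hx y hy a b ha hb hab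
  · rw [add_comm]
    exact key y hy x hx b a hb ha (by linarith)
  · exact Or.inr (hb₂.convex hx hy ha hb hab)

/-- An admissible pair has two non-separating common supporting lines, and touches one of them at
different points. -/
theorem Admissible.exists_normals (hD : Admissible D₁ D₂) :
    ∃ e e' : Plane, ‖e‖ = 1 ∧ ‖e'‖ = 1 ∧ e ≠ e' ∧ supportFun D₁ e = supportFun D₂ e ∧
      contactPoint D₁ e ≠ contactPoint D₂ e ∧
      ∀ v : Plane, ‖v‖ = 1 → supportFun D₁ v = supportFun D₂ v → v = e ∨ v = e' := by
  have hex : ∃ v : Plane, (‖v‖ = 1 ∧ supportFun D₁ v = supportFun D₂ v) ∧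
      contactPoint D₁ v ≠ contactPoint D₂ v := by
    by_contra! hcon
    refine hD.union_not_convex (convex_union_of_contactPoint_eq hD.isConvexBody_left
      hD.isConvexBody_right hD.c2_left hD.c2_right ?_ fun v h1 h2 => hcon v ⟨h1, h2⟩)
    have hne : {v : Plane | ‖v‖ = 1 ∧ supportFun D₁ v = supportFun D₂ v}.Nonempty := by
      rw [← encard_ne_zero, hD.encard_eq_two]
      norm_num
    exact hne
  obtain ⟨e, he, hne⟩ := hex
  obtain ⟨x, y, hxy, hS⟩ := Set.encard_eq_two.1 hD.encard_eq_two
  have hmem : ∀ v : Plane, (‖v‖ = 1 ∧ supportFun D₁ v = supportFun D₂ v) ↔ v = x ∨ v = y :=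
    fun v => by
      have := congrArg (v ∈ ·) hS
      simpa using this
  have hx := (hmem x).2 (Or.inl rfl)
  have hy := (hmem y).2 (Or.inr rfl)
  rcases (hmem e).1 he with rfl | rfl
  · exact ⟨e, y, he.1, hy.1, hxy, he.2, hne, fun v h1 h2 => (hmem v).1 ⟨h1, h2⟩⟩
  · exact ⟨e, x, he.1, hx.1, hxy.symm, he.2, hne, fun v h1 h2 => ((hmem v).1 ⟨h1, h2⟩).symm⟩

end Lines

/-! ### Both sides of a common tangent -/

section Global

variable {K L D D₁ D₂ : Set Plane} {e f : Plane} {i c : ℝ}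

theorem IsFrame.frameNormal_ne (hF : IsFrame e f) {θ φ : ℝ} (h1 : φ - 2 * Real.pi < θ)
    (h2 : θ < φ) : frameNormal e f θ ≠ frameNormal e f φ := by
  intro h
  have h3 : ⟪frameNormal e f θ, frameNormal e f φ⟫ = Real.cos (θ - φ) := by
    simp only [frameNormal, inner_add_left, inner_add_right, real_inner_smul_left,
      real_inner_smul_right, hF.inner_self_left, hF.inner_self_right, hF.inner_eq_zero,
      hF.inner_eq_zero', Real.cos_sub]
    ring
  rw [h, (hF.isFrame_rotate φ).inner_self_left] at h3
  have := (Real.cos_eq_one_iff_of_lt_of_lt (by linarith) (by linarith [Real.pi_pos])).1 h3.symm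
  linarith

/-- Turning slightly to negative angles favours the body whose contact point lies further back along
`f`, which is `D₁`. The sign then persists, since the next zero of the difference is at `c - 2π`,
the second common normal. -/
theorem IsFrame.supportFun_lt (hF : IsFrame e f) (hb₁ : IsConvexBody D₁) (hb₂ : IsConvexBody D₂)
    (hc₁ : HasC2SupportFun D₁) (hc₂ : HasC2SupportFun D₂)
    (h0 : supportFun D₁ e = supportFun D₂ e)
    (hp : ⟪f, contactPoint D₁ e⟫ < ⟪f, contactPoint D₂ e⟫) (hcpos : 0 < c)
    (hzero : ∀ v : Plane, ‖v‖ = 1 → supportFun D₁ v = supportFun D₂ v →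
      v = e ∨ v = frameNormal e f c) {θ : ℝ} (hθ : -(2 * Real.pi - c) < θ) (hθ0 : θ < 0) :
    supportFun D₂ (frameNormal e f θ) < supportFun D₁ (frameNormal e f θ) := by
  have hcp := (hF.continuous_contactPoint hb₂ hc₂).tendsto 0
  have hff : Tendsto (fun _ : ℝ => f) (𝓝 0) (𝓝 f) := tendsto_const_nhds
  have hnear : ∀ᶠ ψ in 𝓝[<] (0 : ℝ), ⟪f, contactPoint D₁ e⟫ <
      ⟪f, contactPoint D₂ (frameNormal e f ψ)⟫ := by
    refine Filter.Eventually.filter_mono nhdsWithin_le_nhds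
      ((Tendsto.inner (𝕜 := ℝ) hff hcp).eventually_const_lt ?_)
    rwa [frameNormal_zero]
  -- The bound `-1` keeps `ψ` above `-π / 2`, so that its cosine is positive.
  have hI : Ioo (max θ (-1)) 0 ∈ 𝓝[<] (0 : ℝ) :=
    Ioo_mem_nhdsLT (max_lt hθ0 (by norm_num))
  obtain ⟨ψ, hψ, hψ1, hψ2⟩ := (hnear.and hI).exists
  have hψlt : supportFun D₂ (frameNormal e f ψ) < supportFun D₁ (frameNormal e f ψ) := by
    rw [← hb₂.inner_contactPoint]
    refine lt_of_lt_of_le ?_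
      (hb₁.inner_le_supportFun (frameNormal e f ψ) (hb₁.contactPoint_mem_self e))
    have h1 : -1 < ψ := (le_max_right _ _).trans_lt hψ1
    have h2 : 0 < Real.cos ψ :=
      Real.cos_pos_of_mem_Ioo ⟨by linarith [Real.pi_gt_three], by linarith [Real.pi_pos]⟩
    have h3 : Real.sin ψ < 0 :=
      Real.sin_neg_of_neg_of_neg_pi_lt hψ2 (by linarith [Real.pi_gt_three])
    have h4 : ⟪e, contactPoint D₂ (frameNormal e f ψ)⟫ ≤ ⟪e, contactPoint D₁ e⟫ := by
      rw [hb₁.inner_contactPoint, h0]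
      exact hb₂.inner_le_supportFun e (hb₂.contactPoint_mem_self _)
    have h5 := mul_le_mul_of_nonneg_left h4 h2.le
    have h6 := mul_lt_mul_of_neg_left hψ h3
    have hexp : ∀ x : Plane, ⟪frameNormal e f ψ, x⟫ =
        Real.cos ψ * ⟪e, x⟫ + Real.sin ψ * ⟪f, x⟫ := fun x => by
      rw [frameNormal, inner_add_left, real_inner_smul_left, real_inner_smul_left]
    rw [hexp, hexp]
    linarith
  have hθψ : θ < ψ := (le_max_left _ _).trans_lt hψ1
  by_contra! hcon
  have hcont : Continuous fun θ => supportFun D₁ (frameNormal e f θ) -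
      supportFun D₂ (frameNormal e f θ) :=
    (hF.continuous_supportFun hc₁).sub (hF.continuous_supportFun hc₂)
  obtain ⟨χ, hχ, hχ0⟩ := intermediate_value_Icc hθψ.le hcont.continuousOn
    (show (0 : ℝ) ∈ _ from ⟨sub_nonpos.2 hcon, (sub_pos.2 hψlt).le⟩)
  rcases hzero _ (hF.norm_normal χ) (sub_eq_zero.1 hχ0) with h | h
  · exact hF.frameNormal_ne (φ := 0) (by linarith [hχ.1]) (hχ.2.trans_lt hψ2)
      (h.trans (frameNormal_zero e f).symm)
  · exact hF.frameNormal_ne (φ := c) (by linarith [hχ.1]) (by linarith [hχ.2]) h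

theorem hasCommonChord_iff_of_normals (h₁ : IsChordEquivalent K L D₁ i)
    (h₂ : IsChordEquivalent K L D₂ i) (hi : 0 < i) (hF : IsFrame e f)
    (h0 : supportFun D₁ e = supportFun D₂ e)
    (hp : ⟪f, contactPoint D₁ e⟫ < ⟪f, contactPoint D₂ e⟫) (hcpos : 0 < c)
    (hc : c < 2 * Real.pi) (hzero : ∀ v : Plane, ‖v‖ = 1 → supportFun D₁ v = supportFun D₂ v →
      v = e ∨ v = frameNormal e f c) {θ : ℝ} (hθ : c - 2 * Real.pi < θ) (hθc : θ < c) :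
    HasCommonChord K L D₁ (frameNormal e f θ) ↔ HasCommonChord K L D₁ e := by
  rcases lt_trichotomy θ 0 with h | h | h
  · exact (hasCommonChord_iff_of_lt (c := 2 * Real.pi - c) h₁ h₂ hi hF h0 hp
      (fun θ h1 h2 => hF.supportFun_lt h₁.body h₂.body h₁.c2 h₂.c2 h0 hp hcpos hzero h1 h2)
      (by linarith) h).1
  · rw [h, frameNormal_zero]
  -- Positive angles reduce to negative ones by reflecting `f` and exchanging the bodies; the second
  -- common normal then has angle `2π - c`.
  · have hzero' : ∀ v : Plane, ‖v‖ = 1 → supportFun D₂ v = supportFun D₁ v →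
        v = e ∨ v = frameNormal e (-f) (2 * Real.pi - c) := by
      intro v h1 h2
      have h3 : frameNormal e (-f) (2 * Real.pi - c) = frameNormal e f c := by
        rw [frameNormal_neg, neg_sub]
        simp [frameNormal]
      rw [h3]
      exact hzero v h1 h2.symm
    have hp' : ⟪-f, contactPoint D₂ e⟫ < ⟪-f, contactPoint D₁ e⟫ := by
      rw [inner_neg_left, inner_neg_left]
      linarith
    have h3 := (hasCommonChord_iff_of_lt (c := c) (θ₀ := -θ) h₂ h₁ hi hF.neg_right h0.symm hp'
      (fun θ h1 h2 => hF.neg_right.supportFun_lt (c := 2 * Real.pi - c) h₂.body h₁.body h₂.c2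
        h₁.c2 h0.symm hp' (by linarith) hzero' (by linarith) h2)
      (by linarith) (by linarith)).2
    rw [frameNormal_neg, neg_neg] at h3
    rw [h3, HasCommonChord, HasCommonChord, h0]

/-- The right side does not depend on `z`, so one common boundary point makes all of `∂L` common. -/
theorem mem_frontier_iff_hasCommonChord (h₁ : IsChordEquivalent K L D₁ i)
    (h₂ : IsChordEquivalent K L D₂ i) (hi : 0 < i) (hF : IsFrame e f)
    (h0 : supportFun D₁ e = supportFun D₂ e)
    (hp : ⟪f, contactPoint D₁ e⟫ < ⟪f, contactPoint D₂ e⟫) (hcpos : 0 < c)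
    (hc : c < 2 * Real.pi) (hzero : ∀ v : Plane, ‖v‖ = 1 → supportFun D₁ v = supportFun D₂ v →
      v = e ∨ v = frameNormal e f c) {z : Plane} (hz : z ∈ frontier L) :
    z ∈ frontier K ↔ HasCommonChord K L D₁ e := by
  have through : ∀ z ∈ frontier L, ∃ θ ∈ Ico (c - 2 * Real.pi) c, z = frontEnd L D₁ e f θ := by
    intro z hz
    obtain ⟨θ, hθ, t, ht, rfl⟩ := hF.exists_tangent_through h₁.right h₁.body h₁.c2
      h₁.subset_right (c - 2 * Real.pi) hz
    rw [sub_add_cancel] at hθ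
    refine ⟨θ, hθ, ?_⟩
    rw [add_smul_mem_frontier_iff_pos hF h₁.right h₁.body h₁.subset_right θ ht] at hz
    rw [frontEnd, ← hz]
  have inner : ∀ θ, c - 2 * Real.pi < θ → θ < c →
      (frontEnd L D₁ e f θ ∈ frontier K ↔ HasCommonChord K L D₁ e) := by
    intro θ hθ hθc
    rw [← h₁.hasCommonChord_iff hi hF]
    exact hasCommonChord_iff_of_normals h₁ h₂ hi hF h0 hp hcpos hc hzero hθ hθc
  obtain ⟨θ, hθ, rfl⟩ := through z hz
  rcases hθ.1.lt_or_eq with h | rfl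
  · exact inner θ h hθ.2
  -- On the tangent at the second common normal, pass to the other end of the chord. It is the front
  -- end of a chord at another angle, since a back end cannot be the front end at the same angle.
  · rw [h₁.frontEnd_mem_iff_backEnd_mem hi hF]
    obtain ⟨θ', hθ', hbe⟩ := through _
      (backEnd_mem hF h₁.right h₁.body h₁.subset_right (c - 2 * Real.pi))
    rw [hbe]
    rcases hθ'.1.lt_or_eq with h | rfl
    · exact inner θ' h hθ'.2
    · exfalso
      rw [backEnd, frontEnd, add_right_inj] at hbe
      have h3 := smul_left_injective ℝ (hF.tangent_ne_zero _) hbe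
      have h4 := chordRadial_pos hF h₁.right h₁.body h₁.subset_right (c - 2 * Real.pi)
      have h5 := chordRadial_neg_pos hF h₁.right h₁.body h₁.subset_right (c - 2 * Real.pi)
      linarith

theorem frontier_subset_of_admissible (hD : Admissible D₁ D₂) (h₁ : IsChordEquivalent K L D₁ i)
    (h₂ : IsChordEquivalent K L D₂ i) (hi : 0 < i)
    (hne : (frontier K ∩ frontier L).Nonempty) : frontier L ⊆ frontier K := by
  obtain ⟨e, e', he, he', hee', h0, hcp, hzero⟩ := hD.exists_normals
  have hf : ∃ f, IsFrame e f ∧ ⟪f, contactPoint D₁ e⟫ < ⟪f, contactPoint D₂ e⟫ := by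
    obtain ⟨f, hF⟩ := exists_isFrame he
    rcases lt_trichotomy ⟪f, contactPoint D₁ e⟫ ⟪f, contactPoint D₂ e⟫ with h | h | h
    · exact ⟨f, hF, h⟩
    · refine absurd ?_ hcp
      rw [hF.eq_add (contactPoint D₁ e), hF.eq_add (contactPoint D₂ e), h,
        h₁.body.inner_contactPoint, h₂.body.inner_contactPoint, h0]
    · refine ⟨-f, hF.neg_right, ?_⟩
      rw [inner_neg_left, inner_neg_left]
      linarith
  obtain ⟨f, hF, hp⟩ := hf
  obtain ⟨c, hc, rfl⟩ := hF.exists_angle_mem_Ico 0 he'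
  rw [zero_add] at hc
  have hc0 : 0 < c := by
    refine lt_of_le_of_ne hc.1 ?_
    rintro rfl
    exact hee' (frameNormal_zero e f).symm
  obtain ⟨z, hzK, hzL⟩ := hne
  have hgood := (mem_frontier_iff_hasCommonChord h₁ h₂ hi hF h0 hp hc0 hc.2 hzero hzL).1 hzK
  exact fun w hw => (mem_frontier_iff_hasCommonChord h₁ h₂ hi hF h0 hp hc0 hc.2 hzero hw).2 hgood

/-- Each ray from `p` meets each boundary once, so the inclusion forces equal radial functions,
hence equal gauges. -/
theorem eq_of_frontier_subset (hK : IsConvexBody K) (hL : IsConvexBody L) {p : Plane}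
    (hpK : p ∈ interior K) (hpL : p ∈ interior L) (h : frontier L ⊆ frontier K) : K = L := by
  have key : ∀ v : Plane, v ≠ 0 → radialAt K p v = radialAt L p v := fun v hv =>
    ((hK.add_smul_mem_frontier_iff hpK hv (hL.radialAt_pos hpL hv)).1
      (h (hL.add_radialAt_smul_mem hpL hv))).symm
  have hg : gauge ((fun x => x - p) '' K) = gauge ((fun x => x - p) '' L) := by
    ext v
    rcases eq_or_ne v 0 with rfl | hv
    · rw [gauge_zero, gauge_zero]
    · exact inv_injective (key v hv)
  have hmem : ∀ {J : Set Plane}, IsConvexBody J → p ∈ interior J → ∀ x,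
      gauge ((fun x => x - p) '' J) (x - p) ≤ 1 ↔ x ∈ J := by
    intro J hJ hp x
    rw [gauge_le_one_iff_mem_closure (hJ.convex_image_sub p) (image_sub_mem_nhds hp),
      (hJ.isCompact.image (by fun_prop)).isClosed.closure_eq]
    simp
  ext x
  rw [← hmem hK hpK, ← hmem hL hpL, hg]

/-- With equal sums, if `K` does not reach further than `L` along `u`, then `L` does not reach
further than `K` along `-u`. The difference of the gauges thus changes sign on the connected unit
circle, and a zero gives a common boundary point. -/
theorem frontier_inter_nonempty_of_add_eq (hK : IsConvexBody K) (hL : IsConvexBody L)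
    {p u : Plane} (hpK : p ∈ interior K) (hpL : p ∈ interior L) (hu : ‖u‖ = 1) (hi : 0 < i)
    (h : radialAt K p u ^ i + radialAt K p (-u) ^ i =
      radialAt L p u ^ i + radialAt L p (-u) ^ i) : (frontier K ∩ frontier L).Nonempty := by
  have hu0 : u ≠ 0 := by
    rintro rfl
    simp at hu
  have common : ∀ v : Plane, v ≠ 0 → radialAt K p v = radialAt L p v →
      (frontier K ∩ frontier L).Nonempty := fun v hv hv' =>
    ⟨p + radialAt K p v • v, hK.add_radialAt_smul_mem hpK hv,
      hv' ▸ hL.add_radialAt_smul_mem hpL hv⟩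
  have hcont : Continuous fun v => gauge ((fun x => x - p) '' K) v -
      gauge ((fun x => x - p) '' L) v :=
    (continuous_gauge (hK.convex_image_sub p) (image_sub_mem_nhds hpK)).sub
      (continuous_gauge (hL.convex_image_sub p) (image_sub_mem_nhds hpL))
  have opp : ∀ v : Plane, ‖v‖ = 1 → radialAt K p v ≤ radialAt L p v →
      radialAt L p (-v) ≤ radialAt K p (-v) → (frontier K ∩ frontier L).Nonempty := by
    intro v hv h1 h2
    have hv0 : v ≠ 0 := by
      rintro rfl
      simp at hv
    have hrank : 1 < Module.rank ℝ Plane := by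
      rw [← Module.finrank_eq_rank, finrank_euclideanSpace, Fintype.card_fin]
      norm_num
    obtain ⟨w, hw, hw0⟩ := (isPreconnected_sphere hrank (0 : Plane) 1).intermediate_value
      (show -v ∈ Metric.sphere (0 : Plane) 1 by simpa using hv)
      (show v ∈ Metric.sphere (0 : Plane) 1 by simpa using hv) hcont.continuousOn
      (show (0 : ℝ) ∈ _ by
        constructor
        · exact sub_nonpos.2 ((inv_le_inv₀ (hL.gauge_image_sub_pos hpL (neg_ne_zero.2 hv0))
            (hK.gauge_image_sub_pos hpK (neg_ne_zero.2 hv0))).1 h2)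
        · exact sub_nonneg.2 ((inv_le_inv₀ (hK.gauge_image_sub_pos hpK hv0)
            (hL.gauge_image_sub_pos hpL hv0)).1 h1))
    refine common w ?_ ?_
    · rintro rfl
      simp at hw
    · rw [radialAt, radialAt, sub_eq_zero.1 hw0]
  have hn0 := neg_ne_zero.2 hu0
  have p1 := hK.radialAt_pos hpK hu0
  have p2 := hK.radialAt_pos hpK hn0
  have p3 := hL.radialAt_pos hpL hu0
  have p4 := hL.radialAt_pos hpL hn0
  rcases le_total (radialAt K p u) (radialAt L p u) with h1 | h1
  · refine opp u hu h1 ?_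
    rw [← Real.rpow_le_rpow_iff p1.le p3.le hi] at h1
    rw [← Real.rpow_le_rpow_iff p4.le p2.le hi]
    linarith
  · refine opp (-u) (by rwa [norm_neg]) ?_ (by rwa [neg_neg])
    rw [← Real.rpow_le_rpow_iff p3.le p1.le hi] at h1
    rw [← Real.rpow_le_rpow_iff p2.le p4.le hi]
    linarith

end Global

theorem mainTheorem2 (K L D₁ D₂ : Set Plane) (hK : IsConvexBody K) (hL : IsConvexBody L)
    (hD : Admissible D₁ D₂) (hD₁ : D₁ ⊆ interior (K ∩ L)) (hD₂ : D₂ ⊆ interior (K ∩ L))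
    (i : ℝ) (hi : 0 < i)
    (h :
      (∀ D ∈ ({D₁, D₂} : Set (Set Plane)), ∀ ξ u : Plane, ‖ξ‖ = 1 → ‖u‖ = 1 → ⟪u, ξ⟫ = 0 →
        chordRadial K D u ξ ^ i + chordRadial K D (-u) ξ ^ i =
          chordRadial L D u ξ ^ i + chordRadial L D (-u) ξ ^ i) ∨
      ((frontier K ∩ frontier L).Nonempty ∧
        ∀ D ∈ ({D₁, D₂} : Set (Set Plane)), ∀ ξ u : Plane, ‖ξ‖ = 1 → ‖u‖ = 1 → ⟪u, ξ⟫ = 0 →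
          chordRadial K D u ξ ^ i - chordRadial K D (-u) ξ ^ i =
            chordRadial L D u ξ ^ i - chordRadial L D (-u) ξ ^ i)) :
    K = L := by
  rw [interior_inter] at hD₁ hD₂
  -- The two conditions differ only in the sign relating the gaps at opposite ends, and only
  -- absolute values matter from here on.
  have habs : ∀ D ∈ ({D₁, D₂} : Set (Set Plane)), ∀ ξ u : Plane, ‖ξ‖ = 1 → ‖u‖ = 1 →
      ⟪u, ξ⟫ = 0 → |chordRadial K D u ξ ^ i - chordRadial L D u ξ ^ i| =
        |chordRadial K D (-u) ξ ^ i - chordRadial L D (-u) ξ ^ i| := by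
    intro D hD ξ u hξ hu huξ
    rcases h with h | ⟨-, h⟩
    · rw [abs_eq_abs]
      right
      linarith [h D hD ξ u hξ hu huξ]
    · rw [abs_eq_abs]
      left
      linarith [h D hD ξ u hξ hu huξ]
  have h₁ : IsChordEquivalent K L D₁ i := ⟨hK, hL, hD.isConvexBody_left, hD.c2_left,
    fun x hx => (hD₁ hx).1, fun x hx => (hD₁ hx).2, habs D₁ (Or.inl rfl)⟩
  have h₂ : IsChordEquivalent K L D₂ i := ⟨hK, hL, hD.isConvexBody_right, hD.c2_right,
    fun x hx => (hD₂ hx).1, fun x hx => (hD₂ hx).2, habs D₂ (Or.inr rfl)⟩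
  have hmem : ∀ ξ, contactPoint D₁ ξ ∈ interior K ∧ contactPoint D₁ ξ ∈ interior L :=
    fun ξ => hD₁ (h₁.body.contactPoint_mem_self ξ)
  have hne : (frontier K ∩ frontier L).Nonempty := by
    rcases h with h | ⟨h, -⟩
    · obtain ⟨e, -, he, -⟩ := hD.exists_normals
      obtain ⟨f, hF⟩ := exists_isFrame he
      exact frontier_inter_nonempty_of_add_eq hK hL (hmem e).1 (hmem e).2 hF.norm_right hi
        (h D₁ (Or.inl rfl) e f he hF.norm_right hF.inner_eq_zero')
    · exact h
  -- The contact point for the zero vector serves merely as some point of `D₁`.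
  exact eq_of_frontier_subset hK hL (hmem 0).1 (hmem 0).2
    (frontier_subset_of_admissible hD h₁ h₂ hi hne)
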